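/- **Decomposed error representation for the Allen–Cahn equation.** Let $\Omega\subset\mathbb R^d$ be bounded and open, $T,\varepsilon>0$, $\mathcal V=H^1(\Omega)$, $\mathcal V^*=[H^1(\Omega)]^*$; $(\cdot,\cdot)$ is the inner product of $L^2(\Omega)$ (or $L^2(\Omega;\mathbb R^d)$) and $\langle\cdot,\cdot\rangle$ the pairing of $\mathcal V^*$ and $\mathcal V$. Let $\mathcal W=\{v\in L^2(0,T;\mathcal V):\partial_t v\in L^2(0,T;\mathcal V^*)\}$; values $v(t)\in L^2(\Omega)$ of $v\in\mathcal W$ are those of its representative in $C([0,T];L^2(\Omega))$. Let $$\psi(s)=\begin{cases}(s+1)^2,&s<-1,\\ \tfrac14(s^2-1)^2,&-1\le s\le 1,\\ (s-1)^2,&s>1,\end{cases}$$ and let $\psi=\psi_c-\psi_e$ with $\psi_c,\psi_e\in C^2(\mathbb R)$ convex with bounded second derivatives (for example $\psi_c(s)=s^2+\tfrac14$). For $\phi\in\{\psi,\psi_c,\psi_e\}$ put $\phi'^s(a,b)=\int_0^1\phi''(sa+(1-s)b)\,ds$. Let $f\in L^2(0,T;\mathcal V^*)$ (for $f\in L^2(0,T;L^2(\Omega))$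 the pairings with $f$ below are $L^2$ inner products), $u^0,\bar q\in L^2(\Omega)$, $q\in L^2(0,T;L^2(\Omega))$, and $\mathcal Q(v)=(\bar q,v(T))+\int_0^T(q,v)\,dt$. Let $0=t_0<\dots<t_N=T$, $\tau_k=t_k-t_{k-1}$, let $\mathbf N_k$ be the piecewise linear hat functions with $\mathbf N_k(t_j)=\delta_{jk}$, and $Iw_\tau=\sum_{k=0}^N w_k\mathbf N_k$. Put $\bar f_{k+1}=\tau_{k+1}^{-1}\int_{t_k}^{t_{k+1}}f\,dt$, $q_k=\tau_k^{-1}\int_0^T q\,\mathbf N_k\,dt$ for $k\ge1$ and $q_0=\tau_1^{-1}\int_0^Tq\,\mathbf N_0\,dt$. For $k=0,\dots,N$ let $\mathcal S_k=\{v\in H^1(\Omega): v|_K\in\mathbb P^1(K)\ \forall K\in\mathcal K_k\}$, where $\mathcal K_k$ is a mesh of $\Omega$ (finitely many closed cells with nonempty, pairwise disjoint interiors and union $\overline\Omega$). Suppose the following are given. * *Primal solution* $u\in\mathcal W$, $u(0)=u^0$, with $\int_0^T(\langle\partial_tu,v\rangle+(\nabla u,\nabla v)+\varepsilon^{-2}(\psi'(u),v))\,dt=\int_0^T\langle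 f,v\rangle\,dt$ for all $v\in L^2(0,T;\mathcal V)$ (the equation $\partial_t u-\Delta u+\varepsilon^{-2}\psi'(u)=f$ with homogeneous Neumann conditions). * *Time-discrete primal solution* $u_0\in L^2(\Omega)$ with $(u_0,v)=(u^0,v)$ for all $v\in L^2(\Omega)$, and $u_1,\dots,u_N\in\mathcal V$ with, for $0\le k<N$ and all $v\in\mathcal V$, $$\Big(\tfrac{u_{k+1}-u_k}{\tau_{k+1}},v\Big)+(\nabla u_{k+1},\nabla v)+\tfrac1{\varepsilon^2}(\psi_c'(u_{k+1}),v)-\tfrac1{\varepsilon^2}(\psi_e'(u_k),v)=\langle\bar f_{k+1},v\rangle .$$ * *Fully discrete solution* $u_k^h\in\mathcal S_k$, $0\le k\le N$, with $(u_0^h,v)=(u^0,v)$ for all $v\in\mathcal S_0$, satisfying the same scheme (with $u_k,u_{k+1}$ replaced by $u_k^h,u_{k+1}^h$) for all $v\in\mathcal S_{k+1}$, $0\le k<N$. * *Dual solution* $z\in\mathcal W$, $z(T)=\bar q$, with $\int_0^T(-\langle\partial_tz,w\rangle+(\nabla z,\nabla w)+\varepsilon^{-2}(\psi'^s(u,Iu_{\tau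 h})z,w))\,dt=\int_0^T(q,w)\,dt$ for all $w\in L^2(0,T;\mathcal V)$. * *Time-discrete dual solution* $z_0\in L^2(\Omega)$, $z_1,\dots,z_N\in\mathcal V$ with, for all $w\in\mathcal V$, $$-\Big(\tfrac{z_1-z_0}{\tau_1},w\Big)-\tfrac1{\varepsilon^2}(\psi_e'^s(u_0,u_0^h)z_1,w)=(q_0,w),$$ $$-\Big(\tfrac{z_{k+1}-z_k}{\tau_k},w\Big)+(\nabla z_k,\nabla w)+\tfrac1{\varepsilon^2}(\psi_c'^s(u_k,u_k^h)z_k,w)-\tfrac{\tau_{k+1}}{\tau_k}\tfrac1{\varepsilon^2}(\psi_e'^s(u_k,u_k^h)z_{k+1},w)=(q_k,w),\quad 1\le k\le N-1,$$ $$(z_N,w)+\tau_N(\nabla z_N,\nabla w)+\tfrac{\tau_N}{\varepsilon^2}(\psi_c'^s(u_N,u_N^h)z_N,w)=(\bar q,w)+\tau_N(q_N,w).$$ Define, for $v\in\mathcal V$, $$\mathcal R_{\rm PDE}(Iu_{\tau h}(t);v)=\langle f(t),v\rangle-(\partial_tIu_{\tau h}(t),v)-(\nabla Iu_{\tau h}(t),\nabla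 v)-\tfrac1{\varepsilon^2}(\psi'(Iu_{\tau h}(t)),v),$$ $$\langle r_h^{k+1},v\rangle=\langle\bar f_{k+1},v\rangle-\Big(\tfrac{u^h_{k+1}-u^h_k}{\tau_{k+1}},v\Big)-(\nabla u_{k+1}^h,\nabla v)-\tfrac1{\varepsilon^2}(\psi_c'(u^h_{k+1}),v)+\tfrac1{\varepsilon^2}(\psi_e'(u^h_k),v),$$ $$\langle r_\tau^{k+1}(t),v\rangle=(\nabla u_{k+1}^h,\nabla v)+\tfrac1{\varepsilon^2}(\psi_c'(u^h_{k+1}),v)-\tfrac1{\varepsilon^2}(\psi_e'(u^h_k),v)-(\nabla Iu_{\tau h}(t),\nabla v)-\tfrac1{\varepsilon^2}(\psi'(Iu_{\tau h}(t)),v),$$ $$\mathcal R_{\rm s}=(u^0-u_0^h,z_0)+\sum_{k=0}^{N-1}\tau_{k+1}\langle r_h^{k+1},z_{k+1}\rangle,\qquad \operatorname{Osc}=\sum_{k=0}^{N-1}\int_{t_k}^{t_{k+1}}\langle f(t)-\bar f_{k+1},z_{k+1}\rangle\,dt,$$ $$\mathcal R_{\rm t}=(u^0-u_0^h,z(0)-z_0)+\sum_{k=0}^{N-1}\int_{t_k}^{t_{k+1}}\big\{\mathcal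 R_{\rm PDE}(Iu_{\tau h}(t);z(t)-z_{k+1})+\langle r_\tau^{k+1}(t),z_{k+1}\rangle\big\}\,dt .$$ Then the integrands in the next formula and in $\mathcal R_{\rm t}$ are integrable on each $[t_k,t_{k+1}]$, $$\mathcal Q(u)-\mathcal Q(Iu_{\tau h})=(z(0),u^0-u_0^h)+\sum_{k=0}^{N-1}\int_{t_k}^{t_{k+1}}\Big\{\langle f,z\rangle-(\partial_tIu_{\tau h},z)-(\nabla Iu_{\tau h},\nabla z)-\tfrac1{\varepsilon^2}(\psi'(Iu_{\tau h}),z)\Big\}dt=\mathcal R_{\rm s}+\mathcal R_{\rm t},$$ $$\mathcal R_{\rm s}=(z_0,u^0-u_0^h)+\sum_{k=0}^{N-1}\tau_{k+1}\Big\{\langle\bar f_{k+1},z_{k+1}\rangle-\Big(\tfrac{u_{k+1}^h-u_k^h}{\tau_{k+1}},z_{k+1}\Big)-(\nabla z_{k+1},\nabla u_{k+1}^h)-\tfrac1{\varepsilon^2}(\psi_c'(u_{k+1}^h),z_{k+1})+\tfrac1{\varepsilon^2}(\psi_e'(u_k^h),z_{k+1})\Big\},$$ $$\begin{aligned}\mathcal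 R_{\rm t}={}&(z(0)-z_0,u^0-u_0^h)+\sum_{k=0}^{N-1}\int_{t_k}^{t_{k+1}}\Big\{\langle f(t),z(t)-z_{k+1}\rangle-\Big(\tfrac{u_{k+1}^h-u_k^h}{\tau_{k+1}},z(t)-z_{k+1}\Big)-(\nabla Iu_{\tau h}(t),\nabla z(t))+(\nabla u_{k+1}^h,\nabla z_{k+1})\\&-\tfrac1{\varepsilon^2}(\psi'(Iu_{\tau h}(t)),z(t))+\tfrac1{\varepsilon^2}(\psi_c'(u_{k+1}^h),z_{k+1})-\tfrac1{\varepsilon^2}(\psi_e'(u_k^h),z_{k+1})\Big\}\,dt,\end{aligned}$$ and $\operatorname{Osc}=0$. -/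

import Mathlib

open MeasureTheory Set
open scoped ContDiff Topology

noncomputable section

namespace AllenCahn

/-! ### Function spaces in the space variable -/

/-- The Lebesgue space `L²(Ω)` of an open set `Ω ⊆ ℝᵈ`. -/
abbrev L2 {d : ℕ} (Ω : Set (EuclideanSpace ℝ (Fin d))) : Type :=
  Lp ℝ 2 ((volume : Measure (EuclideanSpace ℝ (Fin d))).restrict Ω)

/-- The Lebesgue space `L²(Ω; ℝᵈ)` of square integrable vector fields. -/
abbrev L2Vec {d : ℕ} (Ω : Set (EuclideanSpace ℝ (Fin d))) : Type :=
  Lp (EuclideanSpace ℝ (Fin d)) 2 ((volume : Measure (EuclideanSpace ℝ (Fin d))).restrict Ω)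

/-- `φ` is a test function, i.e. an element of `C_c^∞(Ω)`. -/
structure IsTest {F : Type*} [NormedAddCommGroup F] [NormedSpace ℝ F] (Ω : Set F) (φ : F → ℝ) :
    Prop where
  smooth : ContDiff ℝ ∞ φ
  compact : HasCompactSupport φ
  supp : tsupport φ ⊆ Ω

/-- `G ∈ L²(Ω; ℝᵈ)` is the weak (distributional) gradient of `u ∈ L²(Ω)`. -/
def IsWeakGrad {d : ℕ} (Ω : Set (EuclideanSpace ℝ (Fin d))) (u : L2 Ω) (G : L2Vec Ω) : Prop :=
  ∀ φ : EuclideanSpace ℝ (Fin d) → ℝ, IsTest Ω φ → ∀ i : Fin d,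
    ∫ x in Ω, u x * fderiv ℝ φ x (EuclideanSpace.single i 1) = - ∫ x in Ω, G x i * φ x

lemma IsTest.memLp {d : ℕ} {Ω : Set (EuclideanSpace ℝ (Fin d))}
    {φ : EuclideanSpace ℝ (Fin d) → ℝ} (h : IsTest Ω φ) :
    MemLp φ 2 (volume.restrict Ω) :=
  (h.smooth.continuous.memLp_of_hasCompactSupport h.compact).restrict Ω

lemma IsTest.memLp_fderiv {d : ℕ} {Ω : Set (EuclideanSpace ℝ (Fin d))}
    {φ : EuclideanSpace ℝ (Fin d) → ℝ} (h : IsTest Ω φ) (e : EuclideanSpace ℝ (Fin d)) :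
    MemLp (fun x => fderiv ℝ φ x e) 2 (volume.restrict Ω) := by
  have hc : Continuous (fun x => fderiv ℝ φ x e) :=
    (h.smooth.continuous_fderiv (by simp)).clm_apply continuous_const
  have hs : HasCompactSupport (fun x => fderiv ℝ φ x e) :=
    h.compact.fderiv_apply ℝ e
  exact (hc.memLp_of_hasCompactSupport hs).restrict Ω

lemma memLp_coord {d : ℕ} {Ω : Set (EuclideanSpace ℝ (Fin d))} (G : L2Vec Ω) (i : Fin d) :
    MemLp (fun x => G x i) 2 (volume.restrict Ω) :=
  (EuclideanSpace.proj (𝕜 := ℝ) (ι := Fin d) i : EuclideanSpace ℝ (Fin d) →L[ℝ] ℝ).comp_memLp'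
    (Lp.memLp G)

lemma IsWeakGrad.zero {d : ℕ} (Ω : Set (EuclideanSpace ℝ (Fin d))) :
    IsWeakGrad Ω 0 0 := by
  intro φ _ i
  have h1 : ∫ x in Ω, (0 : L2 Ω) x * fderiv ℝ φ x (EuclideanSpace.single i 1) = 0 :=
    integral_eq_zero_of_ae (by
      filter_upwards [Lp.coeFn_zero ℝ 2 (volume.restrict Ω)] with x hx
      rw [hx]
      simp)
  have h2 : ∫ x in Ω, (0 : L2Vec Ω) x i * φ x = 0 :=
    integral_eq_zero_of_ae (by
      filter_upwards [Lp.coeFn_zero (EuclideanSpace ℝ (Fin d)) 2 (volume.restrict Ω)] with x hx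
      rw [hx]
      simp)
  rw [h1, h2, neg_zero]

lemma IsWeakGrad.add {d : ℕ} {Ω : Set (EuclideanSpace ℝ (Fin d))} {u v : L2 Ω} {G H : L2Vec Ω}
    (hu : IsWeakGrad Ω u G) (hv : IsWeakGrad Ω v H) : IsWeakGrad Ω (u + v) (G + H) := by
  intro φ hφ i
  have h1 : ∫ x in Ω, (u + v) x * fderiv ℝ φ x (EuclideanSpace.single i 1)
      = (∫ x in Ω, u x * fderiv ℝ φ x (EuclideanSpace.single i 1))
        + ∫ x in Ω, v x * fderiv ℝ φ x (EuclideanSpace.single i 1) := by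
    refine Eq.trans (integral_congr_ae ?_)
      (integral_add ((Lp.memLp u).integrable_mul (hφ.memLp_fderiv _))
        ((Lp.memLp v).integrable_mul (hφ.memLp_fderiv _)))
    filter_upwards [Lp.coeFn_add u v] with x hx
    rw [hx, Pi.add_apply]
    exact add_mul _ _ _
  have h2 : ∫ x in Ω, (G + H) x i * φ x = (∫ x in Ω, G x i * φ x) + ∫ x in Ω, H x i * φ x := by
    refine Eq.trans (integral_congr_ae ?_)
      (integral_add ((memLp_coord G i).integrable_mul hφ.memLp)
        ((memLp_coord H i).integrable_mul hφ.memLp))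
    filter_upwards [Lp.coeFn_add G H] with x hx
    rw [hx, Pi.add_apply]
    exact add_mul _ _ _
  rw [h1, h2, hu φ hφ i, hv φ hφ i, neg_add]

lemma IsWeakGrad.smul {d : ℕ} {Ω : Set (EuclideanSpace ℝ (Fin d))} {u : L2 Ω} {G : L2Vec Ω}
    (c : ℝ) (hu : IsWeakGrad Ω u G) : IsWeakGrad Ω (c • u) (c • G) := by
  intro φ hφ i
  have h1 : ∫ x in Ω, (c • u) x * fderiv ℝ φ x (EuclideanSpace.single i 1)
      = c * ∫ x in Ω, u x * fderiv ℝ φ x (EuclideanSpace.single i 1) := by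
    rw [← integral_const_mul]
    refine integral_congr_ae ?_
    filter_upwards [Lp.coeFn_smul c u] with x hx
    simp [hx, mul_assoc]
  have h2 : ∫ x in Ω, (c • G) x i * φ x = c * ∫ x in Ω, G x i * φ x := by
    rw [← integral_const_mul]
    refine integral_congr_ae ?_
    filter_upwards [Lp.coeFn_smul c G] with x hx
    simp [hx, mul_assoc]
  rw [h1, h2, hu φ hφ i, mul_neg]

/-- The Sobolev space `H¹(Ω)`, realised as the space of pairs `(u, ∇u)` in
`L²(Ω) × L²(Ω; ℝᵈ)`, with the norm `(‖u‖² + ‖∇u‖²)^(1/2)`. -/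
def H1 {d : ℕ} (Ω : Set (EuclideanSpace ℝ (Fin d))) :
    Submodule ℝ (WithLp 2 (L2 Ω × L2Vec Ω)) where
  carrier := {p | IsWeakGrad Ω p.fst p.snd}
  zero_mem' := IsWeakGrad.zero Ω
  add_mem' := fun ha hb => IsWeakGrad.add ha hb
  smul_mem' := fun c _ h => IsWeakGrad.smul c h

variable {d : ℕ} {Ω : Set (EuclideanSpace ℝ (Fin d))}

/-- The embedding `H¹(Ω) → L²(Ω)`. -/
def val (v : H1 Ω) : L2 Ω := (v : WithLp 2 (L2 Ω × L2Vec Ω)).fst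

/-- The weak gradient of an `H¹` function. -/
def grad (v : H1 Ω) : L2Vec Ω := (v : WithLp 2 (L2 Ω × L2Vec Ω)).snd

/-- The dual space `[H¹(Ω)]*`; the duality pairing `⟨g, v⟩` is the application `g v`. -/
abbrev H1Dual (Ω : Set (EuclideanSpace ℝ (Fin d))) : Type := StrongDual ℝ (H1 Ω)

/-- A mesh of `Ω`: finitely many closed cells with nonempty, pairwise disjoint interiors
that cover the closure of `Ω`. -/
structure Mesh (Ω : Set (EuclideanSpace ℝ (Fin d))) where
  cells : Set (Set (EuclideanSpace ℝ (Fin d)))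
  finite : cells.Finite
  closed : ∀ K ∈ cells, IsClosed K
  interior_nonempty : ∀ K ∈ cells, (interior K).Nonempty
  disjoint : ∀ K ∈ cells, ∀ L ∈ cells, K ≠ L → Disjoint (interior K) (interior L)
  cover : ⋃₀ cells = closure Ω

/-- The conforming finite element space `{v ∈ H¹(Ω) : v|_K ∈ ℙᵖ(K) for all cells K}`. -/
def feSpace (M : Mesh Ω) (p : ℕ) : Set (H1 Ω) :=
  {v | ∀ K ∈ M.cells, ∃ P : MvPolynomial (Fin d) ℝ, P.totalDegree ≤ p ∧
    ∀ᵐ x ∂(volume.restrict Ω), x ∈ K → val v x = MvPolynomial.eval (fun i => x i) P}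

/-! ### The double well potential and its linearization -/

/-- The truncated quartic double well. -/
def psi (u : ℝ) : ℝ :=
  if u < -1 then (u + 1) ^ 2 else if u ≤ 1 then (u ^ 2 - 1) ^ 2 / 4 else (u - 1) ^ 2

/-- `psi = ψc - ψe` with `ψc`, `ψe` convex, twice continuously differentiable and with bounded
second derivatives (for `ψc` the bound follows, because `psi` has bounded second derivative). -/
structure IsSplitting (ψc ψe : ℝ → ℝ) : Prop where
  eq : ∀ s, psi s = ψc s - ψe s
  convex_c : ConvexOn ℝ univ ψc
  convex_e : ConvexOn ℝ univ ψe
  smooth_c : ContDiff ℝ 2 ψc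
  smooth_e : ContDiff ℝ 2 ψe
  bounded : ∃ C : ℝ, ∀ s, |deriv (deriv ψe) s| ≤ C

/-- `(g(a), b) = ∫_Ω g(a(x)) b(x) dx`. -/
def compPair (g : ℝ → ℝ) (a b : L2 Ω) : ℝ := ∫ x in Ω, g (a x) * b x

/-- The mean-value linearization `ψ'ˢ(a, b) = ∫₀¹ ψ''(s a + (1 - s) b) ds` of `ψ'`. -/
def meanLin (ψ : ℝ → ℝ) (a b : ℝ) : ℝ :=
  ∫ s in (0 : ℝ)..1, deriv (deriv ψ) (s * a + (1 - s) * b)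

/-- `(ψ'ˢ(a, b) z, w) = ∫_Ω ψ'ˢ(a(x), b(x)) z(x) w(x) dx`. -/
def meanLinPair (ψ : ℝ → ℝ) (a b z w : L2 Ω) : ℝ :=
  ∫ x in Ω, meanLin ψ (a x) (b x) * z x * w x

/-! ### Function spaces in the time variable -/

/-- `v ∈ L²(0,T; X)`. -/
def MemL2 {X : Type*} [NormedAddCommGroup X] (T : ℝ) (v : ℝ → X) : Prop :=
  MemLp v 2 (volume.restrict (Ioc 0 T))

/-- `v ∈ L²(0,T; H¹(Ω))` has the weak time derivative `g = ∂ₜ v ∈ L²(0,T; [H¹(Ω)]*)`. -/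
structure IsInW (T : ℝ) (v : ℝ → H1 Ω) (g : ℝ → H1Dual Ω) : Prop where
  mem : MemL2 T v
  mem_deriv : MemL2 T g
  weak : ∀ φ : ℝ → ℝ, IsTest (Ioo 0 T) φ → ∀ w : H1 Ω,
    ∫ t in (0 : ℝ)..T, inner ℝ (val (v t)) (val w) * deriv φ t
      = - ∫ t in (0 : ℝ)..T, g t w * φ t

/-- `c` is a representative of `v` in `C([0,T]; L²(Ω))`. -/
def IsContRep (T : ℝ) (v : ℝ → H1 Ω) (c : ℝ → L2 Ω) : Prop :=
  ContinuousOn c (Icc 0 T) ∧ ∀ᵐ t ∂(volume.restrict (Icc 0 T)), c t = val (v t)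

open Classical in
/-- The value `v(t) ∈ L²(Ω)`, `t ∈ [0,T]`, of a function `v` with `v ∈ L²(0,T; H¹(Ω))` and
`∂ₜ v ∈ L²(0,T; [H¹(Ω)]*)`, i.e. the value at `t` of its representative in `C([0,T]; L²(Ω))`. -/
def trace (T : ℝ) (v : ℝ → H1 Ω) (t : ℝ) : L2 Ω :=
  if h : ∃ c, IsContRep T v c then h.choose t else 0

/-- The goal functional `Q(v) = (q̄, v(T)) + ∫₀ᵀ (q, v) dt`. -/
def goal (T : ℝ) (qbar : L2 Ω) (q : ℝ → L2 Ω) (v : ℝ → H1 Ω) : ℝ :=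
  inner ℝ qbar (trace T v T) + ∫ t in (0 : ℝ)..T, inner ℝ (q t) (val (v t))

/-! ### The continuous problems -/

/-- `u` is a weak solution of `∂ₜ u - Δu + ε⁻² ψ'(u) = f`, `u(0) = u⁰`, with homogeneous Neumann
boundary conditions (which are natural for the test space `L²(0,T; H¹(Ω))`). -/
def IsPrimalSol (T ε : ℝ) (f : ℝ → H1Dual Ω) (u0 : L2 Ω) (u : ℝ → H1 Ω) : Prop :=
  ∃ du : ℝ → H1Dual Ω, IsInW T u du ∧ trace T u 0 = u0 ∧
    ∀ v : ℝ → H1 Ω, MemL2 T v →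
      ∫ t in (0 : ℝ)..T, (du t (v t) + inner ℝ (grad (u t)) (grad (v t))
          + 1 / ε ^ 2 * compPair (deriv psi) (val (u t)) (val (v t)))
        = ∫ t in (0 : ℝ)..T, f t (v t)

/-- `z` is a weak solution of the backward dual problem, linearized between `u` and `uhat`, with
terminal value `z(T) = q̄`. -/
def IsDualSol (T ε : ℝ) (qbar : L2 Ω) (q : ℝ → L2 Ω) (u uhat : ℝ → H1 Ω) (z : ℝ → H1 Ω) : Prop :=
  ∃ dz : ℝ → H1Dual Ω, IsInW T z dz ∧ trace T z T = qbar ∧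
    ∀ w : ℝ → H1 Ω, MemL2 T w →
      ∫ t in (0 : ℝ)..T, (-(dz t (w t)) + inner ℝ (grad (z t)) (grad (w t))
          + 1 / ε ^ 2 * meanLinPair psi (val (u t)) (val (uhat t)) (val (z t)) (val (w t)))
        = ∫ t in (0 : ℝ)..T, inner ℝ (q t) (val (w t))

/-! ### Time discretization -/

/-- `0 = t₀ < t₁ < ⋯ < t_N = T`; only the values `t k` with `k ≤ N` are used. -/
structure IsPartition (T : ℝ) (N : ℕ) (t : ℕ → ℝ) : Prop where
  zero : t 0 = 0
  last : t N = T
  lt : ∀ k < N, t k < t (k + 1)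

/-- The time step `τ_k = t_k - t_{k-1}`, `k ≥ 1`. -/
def tau (t : ℕ → ℝ) (k : ℕ) : ℝ := t k - t (k - 1)

/-- The hat function `𝐍_k` of the partition, `0 ≤ k ≤ N`. -/
def hat (N : ℕ) (t : ℕ → ℝ) (k : ℕ) (s : ℝ) : ℝ :=
  open Classical in
  if k < N ∧ s ∈ Icc (t k) (t (k + 1)) then (t (k + 1) - s) / tau t (k + 1)
  else if 1 ≤ k ∧ s ∈ Icc (t (k - 1)) (t k) then (s - t (k - 1)) / tau t k
  else 0

/-- The piecewise linear time reconstruction `I w_τ = ∑_k 𝐍_k(t) w_k`. -/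
def interp (N : ℕ) (t : ℕ → ℝ) (w : ℕ → H1 Ω) (s : ℝ) : H1 Ω :=
  ∑ k ∈ Finset.range (N + 1), hat N t k s • w k

/-- The time average `f̄_k = τ_k⁻¹ ∫_{t_{k-1}}^{t_k} f dt`, `k ≥ 1`. -/
def favg (t : ℕ → ℝ) (f : ℝ → H1Dual Ω) (k : ℕ) : H1Dual Ω :=
  (tau t k)⁻¹ • ∫ s in (t (k - 1))..(t k), f s

/-- `q_k = τ_k⁻¹ ∫₀ᵀ q 𝐍_k dt` for `k ≥ 1` and `q_0 = τ_1⁻¹ ∫₀ᵀ q 𝐍_0 dt`. -/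
def qdisc (T : ℝ) (N : ℕ) (t : ℕ → ℝ) (q : ℝ → L2 Ω) (k : ℕ) : L2 Ω :=
  (tau t (max k 1))⁻¹ • ∫ s in (0 : ℝ)..T, hat N t k s • q s

/-- The sequence in `L²(Ω)` with entry `a` at `0` and entries `w k ∈ H¹(Ω)` at `k ≥ 1`. -/
def glue (a : L2 Ω) (w : ℕ → H1 Ω) (k : ℕ) : L2 Ω := if k = 0 then a else val (w k)

/-- The time-discrete primal problem for `u_0 = a ∈ L²(Ω)` and `u_k = w k ∈ H¹(Ω)`,
`1 ≤ k ≤ N`. -/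
def IsTimeDiscretePrimal (N : ℕ) (t : ℕ → ℝ) (ε : ℝ) (ψc ψe : ℝ → ℝ) (f : ℝ → H1Dual Ω)
    (u0 : L2 Ω) (a : L2 Ω) (w : ℕ → H1 Ω) : Prop :=
  (∀ v : L2 Ω, (inner ℝ a v : ℝ) = inner ℝ u0 v) ∧
  ∀ k < N, ∀ v : H1 Ω,
    inner ℝ ((tau t (k + 1))⁻¹ • (val (w (k + 1)) - glue a w k)) (val v)
      + inner ℝ (grad (w (k + 1))) (grad v)
      + 1 / ε ^ 2 * compPair (deriv ψc) (val (w (k + 1))) (val v)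
      - 1 / ε ^ 2 * compPair (deriv ψe) (glue a w k) (val v)
      = favg t f (k + 1) v

/-- The fully discrete primal problem with spaces `S k`, `0 ≤ k ≤ N`. -/
def IsFullyDiscretePrimal (N : ℕ) (t : ℕ → ℝ) (ε : ℝ) (ψc ψe : ℝ → ℝ) (f : ℝ → H1Dual Ω)
    (u0 : L2 Ω) (S : ℕ → Set (H1 Ω)) (uh : ℕ → H1 Ω) : Prop :=
  (∀ k ≤ N, uh k ∈ S k) ∧
  (∀ v ∈ S 0, (inner ℝ (val (uh 0)) (val v) : ℝ) = inner ℝ u0 (val v)) ∧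
  ∀ k < N, ∀ v ∈ S (k + 1),
    inner ℝ ((tau t (k + 1))⁻¹ • (val (uh (k + 1)) - val (uh k))) (val v)
      + inner ℝ (grad (uh (k + 1))) (grad v)
      + 1 / ε ^ 2 * compPair (deriv ψc) (val (uh (k + 1))) (val v)
      - 1 / ε ^ 2 * compPair (deriv ψe) (val (uh k)) (val v)
      = favg t f (k + 1) v

/-- The time-discrete dual problem for `z_0 = b ∈ L²(Ω)` and `z_k = z k ∈ H¹(Ω)`, `1 ≤ k ≤ N`,
linearized between the time-discrete primal solution `(a, w)` and the fully discrete one `uh`. -/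
def IsTimeDiscreteDual (T : ℝ) (N : ℕ) (t : ℕ → ℝ) (ε : ℝ) (ψc ψe : ℝ → ℝ) (qbar : L2 Ω)
    (q : ℝ → L2 Ω) (a : L2 Ω) (w : ℕ → H1 Ω) (uh : ℕ → H1 Ω) (b : L2 Ω) (z : ℕ → H1 Ω) : Prop :=
  (∀ v : H1 Ω,
    -inner ℝ ((tau t 1)⁻¹ • (val (z 1) - b)) (val v)
      - 1 / ε ^ 2 * meanLinPair ψe a (val (uh 0)) (val (z 1)) (val v)
      = inner ℝ (qdisc T N t q 0) (val v)) ∧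
  (∀ k, 1 ≤ k → k < N → ∀ v : H1 Ω,
    -inner ℝ ((tau t k)⁻¹ • (val (z (k + 1)) - val (z k))) (val v)
      + inner ℝ (grad (z k)) (grad v)
      + 1 / ε ^ 2 * meanLinPair ψc (val (w k)) (val (uh k)) (val (z k)) (val v)
      - tau t (k + 1) / tau t k * (1 / ε ^ 2)
          * meanLinPair ψe (val (w k)) (val (uh k)) (val (z (k + 1))) (val v)
      = inner ℝ (qdisc T N t q k) (val v)) ∧
  ∀ v : H1 Ω,
    inner ℝ (val (z N)) (val v) + tau t N * inner ℝ (grad (z N)) (grad v)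
      + tau t N * (1 / ε ^ 2)
          * meanLinPair ψc (val (w N)) (val (uh N)) (val (z N)) (val v)
      = inner ℝ qbar (val v) + tau t N * inner ℝ (qdisc T N t q N) (val v)

/-! ### Residuals and error representations -/

/-- The residual `R_PDE(û(s); v)` of a (piecewise) time-differentiable `û`. -/
def resPDE (ε : ℝ) (f : ℝ → H1Dual Ω) (uhat : ℝ → H1 Ω) (s : ℝ) (v : H1 Ω) : ℝ :=
  f s v - inner ℝ (val (deriv uhat s)) (val v) - inner ℝ (grad (uhat s)) (grad v)
    - 1 / ε ^ 2 * compPair (deriv psi) (val (uhat s)) (val v)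

/-- The spatial residual `⟨r_h^{k+1}, v⟩`. -/
def resSpace (t : ℕ → ℝ) (ε : ℝ) (ψc ψe : ℝ → ℝ) (f : ℝ → H1Dual Ω) (uh : ℕ → H1 Ω) (k : ℕ)
    (v : H1 Ω) : ℝ :=
  favg t f (k + 1) v - inner ℝ ((tau t (k + 1))⁻¹ • (val (uh (k + 1)) - val (uh k))) (val v)
    - inner ℝ (grad (uh (k + 1))) (grad v)
    - 1 / ε ^ 2 * compPair (deriv ψc) (val (uh (k + 1))) (val v)
    + 1 / ε ^ 2 * compPair (deriv ψe) (val (uh k)) (val v)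

/-- The temporal residual `⟨r_τ^{k+1}(s), v⟩`. -/
def resTime (N : ℕ) (t : ℕ → ℝ) (ε : ℝ) (ψc ψe : ℝ → ℝ) (uh : ℕ → H1 Ω) (k : ℕ) (s : ℝ)
    (v : H1 Ω) : ℝ :=
  inner ℝ (grad (uh (k + 1))) (grad v)
    + 1 / ε ^ 2 * compPair (deriv ψc) (val (uh (k + 1))) (val v)
    - 1 / ε ^ 2 * compPair (deriv ψe) (val (uh k)) (val v)
    - inner ℝ (grad (interp N t uh s)) (grad v)
    - 1 / ε ^ 2 * compPair (deriv psi) (val (interp N t uh s)) (val v)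

/-- The spatial error representation `R_s(u_{τh}; z_τ)`. -/
def Rs (N : ℕ) (t : ℕ → ℝ) (ε : ℝ) (ψc ψe : ℝ → ℝ) (f : ℝ → H1Dual Ω) (u0 : L2 Ω)
    (uh : ℕ → H1 Ω) (b : L2 Ω) (z : ℕ → H1 Ω) : ℝ :=
  inner ℝ (u0 - val (uh 0)) b
    + ∑ k ∈ Finset.range N, tau t (k + 1) * resSpace t ε ψc ψe f uh k (z (k + 1))

/-- The integrand of the temporal error representation on `(t_k, t_{k+1})`. -/
def RtIntegrand (N : ℕ) (t : ℕ → ℝ) (ε : ℝ) (ψc ψe : ℝ → ℝ) (f : ℝ → H1Dual Ω)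
    (uh : ℕ → H1 Ω) (zc : ℝ → H1 Ω) (z : ℕ → H1 Ω) (k : ℕ) (s : ℝ) : ℝ :=
  resPDE ε f (interp N t uh) s (zc s - z (k + 1)) + resTime N t ε ψc ψe uh k s (z (k + 1))

/-- The temporal error representation `R_t(u_{τh}, u_τ, z, z_τ)`, where `zc` is the solution of the
continuous dual problem and `(b, z)` that of the time-discrete one. -/
def Rt (T : ℝ) (N : ℕ) (t : ℕ → ℝ) (ε : ℝ) (ψc ψe : ℝ → ℝ) (f : ℝ → H1Dual Ω) (u0 : L2 Ω)
    (uh : ℕ → H1 Ω) (zc : ℝ → H1 Ω) (b : L2 Ω) (z : ℕ → H1 Ω) : ℝ :=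
  inner ℝ (u0 - val (uh 0)) (trace T zc 0 - b)
    + ∑ k ∈ Finset.range N, ∫ s in (t k)..(t (k + 1)), RtIntegrand N t ε ψc ψe f uh zc z k s

/-- The data oscillation `Osc` for the discrete forcing `f̄_{k+1}`. -/
def Osc (N : ℕ) (t : ℕ → ℝ) (f : ℝ → H1Dual Ω) (z : ℕ → H1 Ω) : ℝ :=
  ∑ k ∈ Finset.range N, ∫ s in (t k)..(t (k + 1)), (f s - favg t f (k + 1)) (z (k + 1))

end AllenCahn

end

/-!
The identity is the dual-weighted-residual argument. Write `û` for the piecewise linear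
reconstruction of the fully discrete solution and `e = u - û`. The dual equation tested with `e`
expresses `(q̄, e(T)) + ∫ (q, e)` through `z`; the mean-value linearization satisfies
`ψ'ˢ(a, b) (a - b) = ψ'(a) - ψ'(b)` (`meanLin_psi_mul_sub`), so that the nonlinear term becomes
`(ψ'(u) - ψ'(û), z)`. Moving the time derivative from `z` to `e` and using the primal equation
tested with `z` leaves the residual of `û` tested with `z` and the initial error
(`goal_sub_goal_eq`). The splitting into a spatial and a temporal part is algebra: on each time step
the residual is tested with `z - z_{k+1}` and with `z_{k+1}`, and the time average of `f` turns the
part with `z_{k+1}` into the spatial residual plus the integral of the temporal one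
(`IsPartition.integral_discrete_part`).

The analytic content is the theory of functions `v ∈ L²(0,T; V)` with `∂ₜ v ∈ L²(0,T; V*)`: they
have a representative in `C([0,T]; H)` and can be integrated by parts in time. This is proved for an
arbitrary continuous linear map `J : V → H` into a real inner product space, which is complete where
the continuous representative is constructed.
* By the lemma of du Bois-Reymond, `(J v, J ·)` is a primitive of `∂ₜ v` in `V*`
  (`HasWeakDeriv.exists_pivot_eq`).
* For `p = (J v, J z)` the increments `p(t) - p(t - h)` are sums of pairings of increments of these
  primitives with values of `z` and `v`. Divided by `h` and integrated over `(a, b)`, they converge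
  to the integral of `⟨∂ₜ v, z⟩ + ⟨∂ₜ z, v⟩`, because translations are continuous in `L²`
  (`tendsto_integral_difference_quotient`), and to `p(b) - p(a)` if `a`, `b` are Lebesgue points
  (`HasWeakDeriv.exists_inner_sub_inner_eq`).
* With `z = v` this is an energy identity. Applied to `v - v(σ)`, where `‖v(σ)‖²` is at most the
  mean of `‖v‖²` over a short interval, it bounds the square of the oscillation of `J v` on this
  interval by a multiple of the integral of `‖v‖² + ‖∂ₜ v‖²` (`HasWeakDeriv.exists_norm_sub_le`),
  whence the continuous representative.
-/

namespace AllenCahn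

/-! ### Test functions on an interval and the lemma of du Bois-Reymond -/

/-- A compact subset of an open interval lies in a compact interval with nonempty interior. -/
lemma exists_Icc_of_isCompact_subset_Ioo {a b : ℝ} (hab : a < b) {K : Set ℝ} (hK : IsCompact K)
    (h : K ⊆ Ioo a b) : ∃ c d, a < c ∧ c < d ∧ d < b ∧ K ⊆ Icc c d := by
  rcases K.eq_empty_or_nonempty with rfl | hne
  · exact ⟨a + (b - a) / 3, a + 2 * (b - a) / 3, by linarith, by linarith, by linarith,
      empty_subset _⟩
  · obtain ⟨x, hx, hx'⟩ := hK.exists_isLeast hne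
    obtain ⟨y, hy, hy'⟩ := hK.exists_isGreatest hne
    have hxa := (h hx).1
    have hxb := (h hy).2
    have hxy : x ≤ y := hx' hy
    refine ⟨(a + x) / 2, (y + b) / 2, by linarith, by linarith, by linarith, fun k hk => ?_⟩
    have h1 := hx' hk
    have h2 := hy' hk
    exact ⟨by linarith, by linarith⟩

lemma IsTest.eq_zero_left {a b : ℝ} {φ : ℝ → ℝ} (hφ : IsTest (Ioo a b) φ) : φ a = 0 :=
  image_eq_zero_of_notMem_tsupport fun h => lt_irrefl _ (hφ.supp h).1

lemma IsTest.eq_zero_right {a b : ℝ} {φ : ℝ → ℝ} (hφ : IsTest (Ioo a b) φ) : φ b = 0 :=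
  image_eq_zero_of_notMem_tsupport fun h => lt_irrefl _ (hφ.supp h).2

/-- A test function of integral zero is the derivative of a test function. -/
lemma IsTest.exists_primitive {T : ℝ} (hT : 0 < T) {χ : ℝ → ℝ} (hχ : IsTest (Ioo 0 T) χ)
    (h0 : ∫ t in (0 : ℝ)..T, χ t = 0) :
    ∃ φ, IsTest (Ioo 0 T) φ ∧ deriv φ = χ := by
  have hc : Continuous χ := hχ.smooth.continuous
  have hd : ∀ x, HasDerivAt (fun x => ∫ t in (0 : ℝ)..x, χ t) (χ x) x := fun x =>
    intervalIntegral.integral_hasDerivAt_right (hc.intervalIntegrable _ _)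
      hc.stronglyMeasurable.stronglyMeasurableAtFilter hc.continuousAt
  have hd' : deriv (fun x => ∫ t in (0 : ℝ)..x, χ t) = χ := funext fun x => (hd x).deriv
  obtain ⟨c, d, hac, hcd, hdb, hK⟩ := exists_Icc_of_isCompact_subset_Ioo hT hχ.compact hχ.supp
  have hz : ∀ x, x ∉ Icc c d → ∫ t in (0 : ℝ)..x, χ t = 0 := by
    intro x hx
    rcases lt_or_ge x c with h | h
    · refine (intervalIntegral.integral_congr (g := fun _ => 0) fun t ht => ?_).trans (by simp)
      refine image_eq_zero_of_notMem_tsupport fun hmem => ?_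
      have := (hK hmem).1
      have h2 : t ≤ max 0 x := ht.2
      rcases le_max_iff.1 h2 with h2 | h2 <;> linarith
    · have hx' : d < x := by
        by_contra hcon
        exact hx ⟨h, not_lt.1 hcon⟩
      rw [← intervalIntegral.integral_add_adjacent_intervals (hc.intervalIntegrable 0 T)
        (hc.intervalIntegrable T x), h0, zero_add]
      refine (intervalIntegral.integral_congr (g := fun _ => 0) fun t ht => ?_).trans (by simp)
      refine image_eq_zero_of_notMem_tsupport fun hmem => ?_
      have := (hK hmem).2
      have h2 : min T x ≤ t := ht.1
      rcases min_le_iff.1 h2 with h2 | h2 <;> linarith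
  have hsub : tsupport (fun x => ∫ t in (0 : ℝ)..x, χ t) ⊆ Icc c d := by
    refine closure_minimal (fun x hx => ?_) isClosed_Icc
    by_contra hcon
    exact hx (hz x hcon)
  refine ⟨_, ⟨?_, ?_, ?_⟩, hd'⟩
  · rw [contDiff_infty_iff_deriv, hd']
    exact ⟨fun x => (hd x).differentiableAt, hχ.smooth⟩
  · exact HasCompactSupport.of_support_subset_isCompact isCompact_Icc
      ((subset_tsupport _).trans hsub)
  · exact hsub.trans fun x hx => ⟨hac.trans_le hx.1, hx.2.trans_lt hdb⟩

lemma exists_isTest_integral_eq_one {T : ℝ} (hT : 0 < T) :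
    ∃ φ : ℝ → ℝ, IsTest (Ioo 0 T) φ ∧ ∫ t in (0 : ℝ)..T, φ t = 1 := by
  let B : ContDiffBump (T / 2) := ⟨T / 8, T / 4, by linarith, by linarith⟩
  have hsub : tsupport (B.normed volume) ⊆ Ioo 0 T := by
    rw [B.tsupport_normed_eq]
    intro x hx
    have hx' : |x - T / 2| ≤ T / 4 := by simpa [Real.dist_eq] using hx
    rw [abs_le] at hx'
    exact ⟨by linarith, by linarith⟩
  refine ⟨B.normed volume, ⟨B.contDiff_normed, B.hasCompactSupport_normed, hsub⟩, ?_⟩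
  rw [intervalIntegral.integral_eq_integral_of_support_subset, B.integral_normed]
  exact (subset_tsupport _).trans (hsub.trans Ioo_subset_Ioc_self)

/-- The lemma of **du Bois-Reymond** for functions with values in a Banach space: a function whose
distributional derivative on `(0, T)` vanishes is constant. -/
lemma ae_eq_const_of_integral_deriv_smul_eq_zero {X : Type*} [NormedAddCommGroup X]
    [NormedSpace ℝ X] [CompleteSpace X] {T : ℝ} (hT : 0 < T) {F : ℝ → X}
    (hF : IntegrableOn F (Ioc 0 T))
    (h : ∀ φ : ℝ → ℝ, IsTest (Ioo 0 T) φ → ∫ t in (0 : ℝ)..T, deriv φ t • F t = 0) :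
    ∃ c : X, ∀ᵐ t ∂(volume.restrict (Ioc 0 T)), F t = c := by
  obtain ⟨φ₀, hφ₀, h1⟩ := exists_isTest_integral_eq_one hT
  have hFi : IntervalIntegrable F volume 0 T :=
    (intervalIntegrable_iff_integrableOn_Ioc_of_le hT.le).2 hF
  have hint : ∀ φ : ℝ → ℝ, IsTest (Ioo 0 T) φ →
      IntervalIntegrable (fun t => φ t • F t) volume 0 T := fun φ hφ =>
    hFi.continuousOn_smul hφ.smooth.continuous.continuousOn
  set c := ∫ t in (0 : ℝ)..T, φ₀ t • F t with hc
  refine ⟨c, ?_⟩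
  have key : ∀ ψ : ℝ → ℝ, IsTest (Ioo 0 T) ψ →
      ∫ t in (0 : ℝ)..T, ψ t • (F t - c) = 0 := by
    intro ψ hψ
    set m := ∫ t in (0 : ℝ)..T, ψ t with hm
    have hψi : IntervalIntegrable ψ volume 0 T := hψ.smooth.continuous.intervalIntegrable _ _
    have hφi : IntervalIntegrable φ₀ volume 0 T := hφ₀.smooth.continuous.intervalIntegrable _ _
    -- `ψ - (∫ ψ) φ₀` has integral zero, hence is the derivative of a test function
    have hχ : IsTest (Ioo 0 T) (fun t => ψ t - m * φ₀ t) := by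
      have hs : tsupport (fun t => ψ t - m * φ₀ t) ⊆ tsupport ψ ∪ tsupport φ₀ := by
        refine (tsupport_sub ψ (fun t => m * φ₀ t)).trans (union_subset_union_right _ ?_)
        exact closure_mono fun x hx => right_ne_zero_of_mul hx
      exact ⟨hψ.smooth.sub (contDiff_const.mul hφ₀.smooth),
        (hψ.compact.isCompact.union hφ₀.compact.isCompact).of_isClosed_subset
          (isClosed_tsupport _) hs, hs.trans (union_subset hψ.supp hφ₀.supp)⟩
    obtain ⟨φ, hφ, hφd⟩ := hχ.exists_primitive hT (by
      rw [intervalIntegral.integral_sub hψi (hφi.const_mul m),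
        intervalIntegral.integral_const_mul, h1, mul_one, sub_self])
    have h2 := h φ hφ
    simp only [hφd, sub_smul, mul_smul] at h2
    have hm₀ : IntervalIntegrable (fun t => m • φ₀ t • F t) volume 0 T := (hint φ₀ hφ₀).smul m
    rw [intervalIntegral.integral_sub (hint ψ hψ) hm₀,
      intervalIntegral.integral_smul, ← hc] at h2
    simp only [smul_sub]
    rw [intervalIntegral.integral_sub (hint ψ hψ)
      (hψi.smul_continuousOn continuousOn_const),
      intervalIntegral.integral_smul_const]
    exact h2
  have := isOpen_Ioo.ae_eq_zero_of_integral_contDiff_smul_eq_zero (μ := volume)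
    (U := Ioo 0 T) (f := fun t => F t - c) (by
      have : IntegrableOn (fun t => F t - c) (Ioc 0 T) :=
        hF.sub (integrableOn_const (by simp))
      exact (this.mono_set Ioo_subset_Ioc_self).locallyIntegrableOn) (by
      intro ψ h1 h2 h3
      rw [← key ψ ⟨h1, h2, h3⟩, intervalIntegral.integral_eq_integral_of_support_subset]
      intro x hx
      have : ψ x ≠ 0 := fun h => hx (by simp [h])
      exact Ioo_subset_Ioc_self (h3 (subset_tsupport _ this)))
  rw [← restrict_Ioo_eq_restrict_Ioc, ae_restrict_iff' measurableSet_Ioo]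
  filter_upwards [this] with t ht hmem using sub_eq_zero.1 (ht hmem)

/-! ### Weak time derivatives with values in a dual space -/

section GelfandTriple

variable {V H : Type*} [NormedAddCommGroup V] [NormedSpace ℝ V] [NormedAddCommGroup H]
  [InnerProductSpace ℝ H]

/-- The map `V → V*`, `v ↦ (J v, J ·)` induced by a continuous linear map `J` of `V` into the
pivot space `H`. -/
noncomputable def pivot (J : V →L[ℝ] H) : V →L[ℝ] StrongDual ℝ V :=
  (innerSL ℝ).bilinearComp J J

lemma pivot_apply (J : V →L[ℝ] H) (v w : V) : pivot J v w = inner ℝ (J v) (J w) := rfl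

/-- `v ∈ L²(0,T; V)` has the weak time derivative `g ∈ L²(0,T; V*)` with respect to the map `J` of
`V` into the pivot space. -/
structure HasWeakDeriv (J : V →L[ℝ] H) (T : ℝ) (v : ℝ → V) (g : ℝ → StrongDual ℝ V) : Prop where
  mem : MemL2 T v
  mem_deriv : MemL2 T g
  weak : ∀ φ : ℝ → ℝ, IsTest (Ioo 0 T) φ → ∀ w : V,
    ∫ t in (0 : ℝ)..T, inner ℝ (J (v t)) (J w) * deriv φ t = - ∫ t in (0 : ℝ)..T, g t w * φ t

lemma MemL2.integrableOn {X : Type*} [NormedAddCommGroup X] {T : ℝ} {v : ℝ → X}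
    (h : MemL2 T v) : IntegrableOn v (Ioc 0 T) :=
  MemLp.integrable (by norm_num) h

lemma intervalIntegrable_dual_const {g : ℝ → StrongDual ℝ V} {a b : ℝ}
    (hg : IntervalIntegrable g volume a b) (w : V) :
    IntervalIntegrable (fun s => g s w) volume a b :=
  ⟨(ContinuousLinearMap.apply ℝ ℝ w).integrable_comp hg.1,
    (ContinuousLinearMap.apply ℝ ℝ w).integrable_comp hg.2⟩

lemma intervalIntegral_dual_const {g : ℝ → StrongDual ℝ V} {a b : ℝ}
    (hg : IntervalIntegrable g volume a b) (w : V) :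
    ∫ s in a..b, g s w = (∫ s in a..b, g s) w :=
  (ContinuousLinearMap.intervalIntegral_apply hg w).symm

/-- Integration by parts for the product of a primitive and a test function. -/
lemma IsTest.integral_primitive_mul_deriv {T : ℝ} {φ : ℝ → ℝ}
    (hφ : IsTest (Ioo 0 T) φ) {g : ℝ → ℝ} (hg : IntervalIntegrable g volume 0 T) :
    ∫ t in (0 : ℝ)..T, (∫ s in (0 : ℝ)..t, g s) * deriv φ t = - ∫ t in (0 : ℝ)..T, g t * φ t := by
  have hG := hg.absolutelyContinuousOnInterval_intervalIntegral (c := 0) left_mem_uIcc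
  have hΦ : AbsolutelyContinuousOnInterval φ 0 T :=
    ((hφ.smooth.of_le (by simp)).contDiffOn).absolutelyContinuousOnInterval
  rw [hG.integral_mul_deriv_eq_deriv_mul hΦ, hφ.eq_zero_left, hφ.eq_zero_right]
  simp only [mul_zero, sub_zero, zero_sub, neg_inj]
  refine intervalIntegral.integral_congr_ae ?_
  filter_upwards [hg.ae_hasDerivAt_integral] with x hx hmem
  rw [(hx (uIoc_subset_uIcc hmem) 0 left_mem_uIcc).deriv]

/-- A function with a weak time derivative `g` is, as a function with values in `V*`, almost
everywhere a primitive of `g`. -/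
lemma HasWeakDeriv.exists_pivot_eq {J : V →L[ℝ] H} {T : ℝ} (hT : 0 < T) {v : ℝ → V}
    {g : ℝ → StrongDual ℝ V} (h : HasWeakDeriv J T v g) :
    ∃ C : StrongDual ℝ V, ∀ᵐ t ∂(volume.restrict (Ioc 0 T)),
      pivot J (v t) = C + ∫ s in (0 : ℝ)..t, g s := by
  have hgi : IntervalIntegrable g volume 0 T :=
    (intervalIntegrable_iff_integrableOn_Ioc_of_le hT.le).2 h.mem_deriv.integrableOn
  have hvi : IntervalIntegrable (fun t => pivot J (v t)) volume 0 T :=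
    (intervalIntegrable_iff_integrableOn_Ioc_of_le hT.le).2
      ((pivot J).integrable_comp h.mem.integrableOn)
  have hGc : ContinuousOn (fun t => ∫ s in (0 : ℝ)..t, g s) (uIcc 0 T) :=
    intervalIntegral.continuousOn_primitive_interval' hgi left_mem_uIcc
  have hFi : IntervalIntegrable (fun t => pivot J (v t) - ∫ s in (0 : ℝ)..t, g s) volume 0 T :=
    hvi.sub hGc.intervalIntegrable
  obtain ⟨C, hC⟩ := ae_eq_const_of_integral_deriv_smul_eq_zero hT
    ((intervalIntegrable_iff_integrableOn_Ioc_of_le hT.le).1 hFi) (fun φ hφ => by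
      have hφc : Continuous (deriv φ) := hφ.smooth.continuous_deriv (by simp)
      ext w
      rw [ContinuousLinearMap.intervalIntegral_apply (hFi.continuousOn_smul hφc.continuousOn)]
      have hgw : IntervalIntegrable (fun s => g s w) volume 0 T :=
        intervalIntegrable_dual_const hgi w
      have hvw : IntervalIntegrable (fun s => inner ℝ (J (v s)) (J w)) volume 0 T :=
        intervalIntegrable_dual_const hvi w
      have hGw : ContinuousOn (fun t => ∫ s in (0 : ℝ)..t, g s w) (uIcc 0 T) :=
        intervalIntegral.continuousOn_primitive_interval' hgw left_mem_uIcc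
      have e1 := h.weak φ hφ w
      have e2 := hφ.integral_primitive_mul_deriv hgw
      have e3 : ∫ t in (0 : ℝ)..T, (inner ℝ (J (v t)) (J w) * deriv φ t
          - (∫ s in (0 : ℝ)..t, g s w) * deriv φ t) = 0 := by
        have hi : IntervalIntegrable (fun t => (∫ s in (0 : ℝ)..t, g s w) * deriv φ t)
            volume 0 T := (hGw.mul hφc.continuousOn).intervalIntegrable
        rw [intervalIntegral.integral_sub (hvw.mul_continuousOn hφc.continuousOn) hi, e1, e2,
          sub_self]
      refine Eq.trans ?_ e3
      refine intervalIntegral.integral_congr fun t ht => ?_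
      have : IntervalIntegrable g volume 0 t :=
        hgi.mono_set (uIcc_subset_uIcc left_mem_uIcc ht)
      simp only [smul_apply, sub_apply, smul_eq_mul,
        ContinuousLinearMap.intervalIntegral_apply this, pivot_apply]
      ring)
  exact ⟨C, hC.mono fun t ht => by rw [← ht]; abel⟩

end GelfandTriple

/-! ### Translations and difference quotients in `L²` -/

section Translation

variable {V : Type*} [NormedAddCommGroup V] [NormedSpace ℝ V]

/-- The pairing of two square integrable functions with values in `V*` and `V` is integrable. -/
lemma integrable_dual_apply {α : Type*} [MeasurableSpace α] {μ : Measure α}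
    {g : α → StrongDual ℝ V} {z : α → V} (hg : MemLp g 2 μ) (hz : MemLp z 2 μ) :
    Integrable (fun t => g t (z t)) μ := by
  refine (hg.norm.integrable_mul hz.norm).mono'
    ((ContinuousLinearMap.id ℝ (StrongDual ℝ V)).aestronglyMeasurable_comp₂ hg.1 hz.1) ?_
  exact Filter.Eventually.of_forall fun t => (g t).le_opNorm _

open DomAddAct in
/-- Continuity of translations in `L²`, tested against the duality pairing. -/
lemma continuous_integral_dual_apply_translate {g : ℝ → StrongDual ℝ V} {z : ℝ → V}
    (hg : MemLp g 2 volume) (hz : MemLp z 2 volume) (s : Set ℝ) :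
    Continuous fun q : ℝ × ℝ => ∫ t in s, g (t - q.1) (z (t - q.2)) := by
  have : Fact ((2 : ENNReal) ≠ ⊤) := ⟨by norm_num⟩
  have hc : Continuous fun q : ℝ × ℝ =>
      (ContinuousLinearMap.id ℝ (StrongDual ℝ V)).holderL volume 2 2 1
        (mk (-q.1) +ᵥ hg.toLp g) (mk (-q.2) +ᵥ hz.toLp z) := by
    have h1 : Continuous fun q : ℝ × ℝ => (mk (-q.1) +ᵥ hg.toLp g : Lp _ 2 volume) :=
      (continuous_mk.comp continuous_fst.neg).vadd continuous_const
    have h2 : Continuous fun q : ℝ × ℝ => (mk (-q.2) +ᵥ hz.toLp z : Lp _ 2 volume) :=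
      (continuous_mk.comp continuous_snd.neg).vadd continuous_const
    fun_prop
  convert (continuous_setIntegral s).comp hc using 2 with q
  refine integral_congr_ae (ae_restrict_of_ae ?_)
  have e1 := (ContinuousLinearMap.id ℝ (StrongDual ℝ V)).coeFn_holder (r := 1)
    (mk (-q.1) +ᵥ hg.toLp g) (mk (-q.2) +ᵥ hz.toLp z)
  rw [mk_vadd_toLp, mk_vadd_toLp] at e1
  filter_upwards [e1, (hg.comp_measurePreserving (measurePreserving_vadd (-q.1) volume)).coeFn_toLp,
    (hz.comp_measurePreserving (measurePreserving_vadd (-q.2) volume)).coeFn_toLp] with t h1 h2 h3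
  refine Eq.trans ?_ h1.symm
  rw [sub_eq_neg_add, sub_eq_neg_add]
  exact congrArg₂ (fun (a : StrongDual ℝ V) b => a b) h2.symm h3.symm

/-- Fubini's theorem for the pairing of the increments of a primitive with a function. -/
lemma setIntegral_primitive_increment_apply {g : ℝ → StrongDual ℝ V} {z : ℝ → V}
    (hg : MemLp g 2 volume) (hz : MemLp z 2 volume) (a b : ℝ) {h : ℝ} (hh : 0 ≤ h) :
    ∫ t in Ioc a b, (∫ s in (t - h)..t, g s) (z t)
      = ∫ r in (0 : ℝ)..h, ∫ t in Ioc a b, g (t - r) (z t) := by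
  have hgi : ∀ x y : ℝ, IntervalIntegrable g volume x y := fun x y =>
    intervalIntegrable_iff.2 ((LocallyIntegrable.integrableOn_isCompact
      (hg.locallyIntegrable (by norm_num)) isCompact_uIcc).mono_set uIoc_subset_uIcc)
  have e1 : ∀ t, (∫ s in (t - h)..t, g s) (z t) = ∫ r in Ioc 0 h, g (t - r) (z t) := by
    intro t
    rw [ContinuousLinearMap.intervalIntegral_apply (hgi _ _),
      ← intervalIntegral.integral_of_le hh,
      intervalIntegral.integral_comp_sub_left (fun s => g s (z t)) t, sub_zero]
  simp only [e1]
  rw [intervalIntegral.integral_of_le hh]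
  refine integral_integral_swap ?_
  -- integrability on the product follows from `2 |⟨g(t - r), z(t)⟩| ≤ ‖g(t - r)‖² + ‖z(t)‖²`
  have hg2 : Integrable (fun t => ‖g t‖ ^ 2) volume := hg.norm.integrable_sq
  have hz2 : Integrable (fun t => ‖z t‖ ^ 2) (volume.restrict (Ioc a b)) :=
    (hz.norm.integrable_sq).integrableOn
  have h1 : Integrable (fun _ : ℝ => (1 : ℝ)) (volume.restrict (Ioc 0 h)) :=
    integrable_const _
  have b1 : Integrable (fun p : ℝ × ℝ => 1 * ‖g (p.1 - p.2)‖ ^ 2)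
      ((volume.restrict (Ioc a b)).prod (volume.restrict (Ioc 0 h))) := by
    have := h1.convolution_integrand (ContinuousLinearMap.mul ℝ ℝ) hg2
    exact this.mono_measure (Measure.prod_mono Measure.restrict_le_self le_rfl)
  have b2 : Integrable (fun p : ℝ × ℝ => ‖z p.1‖ ^ 2 * 1)
      ((volume.restrict (Ioc a b)).prod (volume.restrict (Ioc 0 h))) := hz2.mul_prod h1
  refine (b1.add b2).mono' ?_ (Filter.Eventually.of_forall fun p => ?_)
  · refine (ContinuousLinearMap.id ℝ (StrongDual ℝ V)).aestronglyMeasurable_comp₂ ?_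
      (hz.1.restrict.comp_fst)
    have hq := (quasiMeasurePreserving_sub_of_right_invariant (volume : Measure ℝ) volume)
    have hm : AEStronglyMeasurable (fun p : ℝ × ℝ => g (p.1 - p.2)) (volume.prod volume) :=
      hg.1.comp_quasiMeasurePreserving hq
    exact hm.mono_measure (Measure.prod_mono Measure.restrict_le_self Measure.restrict_le_self)
  · have hb : ‖g (p.1 - p.2) (z p.1)‖ ≤ ‖g (p.1 - p.2)‖ * ‖z p.1‖ := (g (p.1 - p.2)).le_opNorm _
    have := two_mul_le_add_sq ‖g (p.1 - p.2)‖ ‖z p.1‖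
    have := norm_nonneg (g (p.1 - p.2) (z p.1))
    simp only [Function.uncurry, Pi.add_apply]
    linarith

/-- The backward difference quotients of a primitive of `g` converge to `g` in `L²(a,b; V*)`, here
tested against the translates of a function `z` by `c h`. The cases `c = 0` and `c = 1` occur in the
discrete product rule. -/
lemma tendsto_integral_difference_quotient {g : ℝ → StrongDual ℝ V} {z : ℝ → V}
    (hg : MemLp g 2 volume) (hz : MemLp z 2 volume) (a b c : ℝ) :
    Filter.Tendsto (fun h => h⁻¹ * ∫ t in Ioc a b, (∫ s in (t - h)..t, g s) (z (t - c * h)))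
      (𝓝[>] 0) (𝓝 (∫ t in Ioc a b, g t (z t))) := by
  set Φ : ℝ × ℝ → ℝ := fun q => ∫ t in Ioc a b, g (t - q.1) (z (t - q.2)) with hΦ
  have hc : Continuous Φ := continuous_integral_dual_apply_translate hg hz _
  have h0 : ∫ t in Ioc a b, g t (z t) = Φ (0, 0) := by simp [hΦ]
  rw [h0, Metric.tendsto_nhdsWithin_nhds]
  intro e he
  obtain ⟨δ, hδ, hδ'⟩ := Metric.continuousAt_iff.1 hc.continuousAt (e / 2) (half_pos he)
  refine ⟨δ / (1 + |c|), by positivity, fun h (hh : 0 < h) hhd => ?_⟩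
  have hhd' : (1 + |c|) * h < δ := by
    rw [dist_zero_right, Real.norm_eq_abs, abs_of_pos hh, lt_div_iff₀ (by positivity)] at hhd
    linarith
  have hch : |c * h| = |c| * h := by rw [abs_mul, abs_of_pos hh]
  have hch0 : 0 ≤ |c| * h := by positivity
  have hzc : MemLp (fun t => z (t - c * h)) 2 volume :=
    hz.comp_measurePreserving (measurePreserving_sub_right volume (c * h))
  rw [setIntegral_primitive_increment_apply hg hzc a b hh.le]
  change dist (h⁻¹ * ∫ r in (0 : ℝ)..h, Φ (r, c * h)) _ < e
  have hi : IntervalIntegrable (fun r => Φ (r, c * h)) volume 0 h :=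
    (hc.comp (by fun_prop : Continuous fun r : ℝ => (r, c * h))).intervalIntegrable _ _
  have e1 : h⁻¹ * (∫ r in (0 : ℝ)..h, Φ (r, c * h)) - Φ (0, 0)
      = h⁻¹ * ∫ r in (0 : ℝ)..h, (Φ (r, c * h) - Φ (0, 0)) := by
    rw [intervalIntegral.integral_sub hi (by simp), intervalIntegral.integral_const, smul_eq_mul,
      sub_zero, mul_sub, inv_mul_cancel_left₀ hh.ne']
  have e2 : ‖∫ r in (0 : ℝ)..h, (Φ (r, c * h) - Φ (0, 0))‖ ≤ e / 2 * |h - 0| := by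
    refine intervalIntegral.norm_integral_le_of_norm_le_const fun r hr => ?_
    rw [uIoc_of_le hh.le] at hr
    rw [← dist_eq_norm]
    refine (hδ' ?_).le
    rw [Prod.dist_eq, max_lt_iff, dist_zero_right, dist_zero_right, Real.norm_eq_abs,
      Real.norm_eq_abs, hch, abs_of_pos hr.1]
    constructor <;> linarith [hr.2]
  rw [Real.dist_eq, e1, abs_mul, abs_of_pos (inv_pos.2 hh)]
  rw [sub_zero, abs_of_pos hh, Real.norm_eq_abs] at e2
  calc h⁻¹ * _ ≤ h⁻¹ * (e / 2 * h) := by gcongr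
    _ = e / 2 := by field_simp
    _ < e := half_lt_self he

end Translation

/-! ### The product rule at Lebesgue points -/

section ProductRule

variable {V H : Type*} [NormedAddCommGroup V] [NormedSpace ℝ V] [NormedAddCommGroup H]
  [InnerProductSpace ℝ H]

lemma MemL2.memLp_indicator {X : Type*} [NormedAddCommGroup X] {T : ℝ} {v : ℝ → X}
    (h : MemL2 T v) : MemLp ((Ioc 0 T).indicator v) 2 volume :=
  (memLp_indicator_iff_restrict measurableSet_Ioc).2 h

/-- Increments of `v` are, in `V*`, integrals of `∂ₜ v`. Extension by zero makes translations
available on the whole line; the formula holds where both times lie in `(0, T]`. -/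
lemma HasWeakDeriv.ae_pivot_increment {J : V →L[ℝ] H} {T : ℝ} (hT : 0 < T) {v : ℝ → V}
    {g : ℝ → StrongDual ℝ V} (hv : HasWeakDeriv J T v g) (h : ℝ) :
    ∀ᵐ t, t ∈ Ioc 0 T → t - h ∈ Ioc 0 T →
      pivot J ((Ioc 0 T).indicator v t - (Ioc 0 T).indicator v (t - h))
        = ∫ s in (t - h)..t, (Ioc 0 T).indicator g s := by
  obtain ⟨C, hC⟩ := hv.exists_pivot_eq hT
  rw [ae_restrict_iff' measurableSet_Ioc] at hC
  have hC' := (measurePreserving_sub_right volume h).quasiMeasurePreserving.ae hC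
  have hgi : IntervalIntegrable g volume 0 T :=
    (intervalIntegrable_iff_integrableOn_Ioc_of_le hT.le).2 hv.mem_deriv.integrableOn
  have hgx : ∀ x ∈ Ioc 0 T, IntervalIntegrable g volume 0 x := fun x hx =>
    hgi.mono_set (uIcc_subset_uIcc left_mem_uIcc (by rw [uIcc_of_le hT.le]; exact ⟨hx.1.le, hx.2⟩))
  filter_upwards [hC, hC'] with t h1 h2 m1 m2
  rw [indicator_of_mem m1, indicator_of_mem m2, map_sub, h1 m1, h2 m2, add_sub_add_left_eq_sub,
    intervalIntegral.integral_interval_sub_left (hgx _ m1) (hgx _ m2)]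
  refine intervalIntegral.integral_congr_ae (Filter.Eventually.of_forall fun s hs => ?_)
  rw [indicator_of_mem]
  rcases mem_uIoc.1 hs with hs | hs
  · exact ⟨m2.1.trans hs.1, hs.2.trans m1.2⟩
  · exact ⟨m1.1.trans hs.1, hs.2.trans m2.2⟩

/-- The product rule of Lions and Magenes at almost all pairs of times: the derivative of
`(J v, J z)` is `⟨∂ₜ v, z⟩ + ⟨∂ₜ z, v⟩`. The exceptional times are those which are not Lebesgue
points of `(J v, J z)`. -/
lemma HasWeakDeriv.exists_inner_sub_inner_eq {J : V →L[ℝ] H} {T : ℝ} (hT : 0 < T)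
    {v z : ℝ → V} {gv gz : ℝ → StrongDual ℝ V} (hv : HasWeakDeriv J T v gv)
    (hz : HasWeakDeriv J T z gz) :
    ∃ S ⊆ Ioo 0 T, (∀ᵐ t, t ∈ Ioo 0 T → t ∈ S) ∧ ∀ a ∈ S, ∀ b ∈ S, a ≤ b →
      inner ℝ (J (v b)) (J (z b)) - inner ℝ (J (v a)) (J (z a))
        = ∫ t in a..b, (gv t (z t) + gz t (v t)) := by
  set v' := (Ioc 0 T).indicator v with hv'
  set z' := (Ioc 0 T).indicator z with hz'
  set gv' := (Ioc 0 T).indicator gv with hgv'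
  set gz' := (Ioc 0 T).indicator gz with hgz'
  have mv : MemLp v' 2 volume := hv.mem.memLp_indicator
  have mz : MemLp z' 2 volume := hz.mem.memLp_indicator
  have mgv : MemLp gv' 2 volume := hv.mem_deriv.memLp_indicator
  have mgz : MemLp gz' 2 volume := hz.mem_deriv.memLp_indicator
  set p : ℝ → ℝ := fun t => pivot J (v' t) (z' t) with hp
  have hpi : Integrable p volume :=
    integrable_dual_apply ((pivot J).comp_memLp' mv) mz
  have hpii : ∀ x y : ℝ, IntervalIntegrable p volume x y := fun x y => hpi.intervalIntegrable
  refine ⟨{x | x ∈ Ioo 0 T ∧ HasDerivAt (fun x => ∫ t in (0 : ℝ)..x, p t) (p x) x},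
    fun x hx => hx.1, ?_, ?_⟩
  · filter_upwards [LocallyIntegrable.ae_hasDerivAt_integral hpi.locallyIntegrable]
      with x hx hm using ⟨hm, hx 0⟩
  rintro a ⟨ha, hda⟩ b ⟨hb, hdb⟩ hab
  have hsub : Ioc a b ⊆ Ioc 0 T := Ioc_subset_Ioc ha.1.le hb.2.le
  set F : ℝ → ℝ := fun x => ∫ t in (0 : ℝ)..x, p t with hF
  have hlim : ∀ x y : ℝ, HasDerivAt F y x →
      Filter.Tendsto (fun h => h⁻¹ * (F x - F (x - h))) (𝓝[>] 0) (𝓝 y) := by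
    intro x y hd
    have hneg : Filter.Tendsto (fun h : ℝ => -h) (𝓝[>] 0) (𝓝[≠] 0) := by
      refine tendsto_nhdsWithin_iff.2 ⟨?_, ?_⟩
      · have : Filter.Tendsto (fun h : ℝ => -h) (𝓝 0) (𝓝 0) := by
          simpa using (continuous_neg (G := ℝ)).tendsto 0
        exact this.mono_left nhdsWithin_le_nhds
      · filter_upwards [self_mem_nhdsWithin] with h hh using neg_ne_zero.2 (ne_of_gt hh)
    refine ((hasDerivAt_iff_tendsto_slope_zero.1 hd).comp hneg).congr fun h => ?_
    simp only [Function.comp_apply, smul_eq_mul, ← sub_eq_add_neg, inv_neg]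
    ring
  have hL := (hlim b _ hdb).sub (hlim a _ hda)
  have hR := (tendsto_integral_difference_quotient mgv mz a b 0).add
    (tendsto_integral_difference_quotient mgz mv a b 1)
  have heq : ∀ᶠ h in 𝓝[>] (0 : ℝ),
      h⁻¹ * (∫ t in Ioc a b, (∫ s in (t - h)..t, gv' s) (z' (t - 0 * h)))
        + h⁻¹ * (∫ t in Ioc a b, (∫ s in (t - h)..t, gz' s) (v' (t - 1 * h)))
      = h⁻¹ * (F b - F (b - h)) - h⁻¹ * (F a - F (a - h)) := by
    filter_upwards [Ioo_mem_nhdsGT ha.1] with h hh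
    have mvh : MemLp (fun t => v' (t - h)) 2 volume :=
      mv.comp_measurePreserving (measurePreserving_sub_right volume h)
    have mzh : MemLp (fun t => z' (t - h)) 2 volume :=
      mz.comp_measurePreserving (measurePreserving_sub_right volume h)
    have hmem : ∀ t ∈ Ioc a b, t ∈ Ioc 0 T ∧ t - h ∈ Ioc 0 T := fun t ht =>
      ⟨hsub ht, by linarith [ht.1, hh.2], by linarith [(hsub ht).2, hh.1]⟩
    have e1 : ∫ t in Ioc a b, (∫ s in (t - h)..t, gv' s) (z' (t - 0 * h))
        = ∫ t in Ioc a b, pivot J (v' t - v' (t - h)) (z' t) := by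
      refine setIntegral_congr_ae measurableSet_Ioc ?_
      filter_upwards [hv.ae_pivot_increment hT h] with t h1 ht
      rw [h1 (hmem t ht).1 (hmem t ht).2, zero_mul, sub_zero]
    have e2 : ∫ t in Ioc a b, (∫ s in (t - h)..t, gz' s) (v' (t - 1 * h))
        = ∫ t in Ioc a b, pivot J (z' t - z' (t - h)) (v' (t - h)) := by
      refine setIntegral_congr_ae measurableSet_Ioc ?_
      filter_upwards [hz.ae_pivot_increment hT h] with t h1 ht
      rw [h1 (hmem t ht).1 (hmem t ht).2, one_mul]
    have i1 : IntegrableOn (fun t => pivot J (v' t - v' (t - h)) (z' t)) (Ioc a b) :=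
      (integrable_dual_apply ((pivot J).comp_memLp' (mv.sub mvh)) mz).integrableOn
    have i2 : IntegrableOn (fun t => pivot J (z' t - z' (t - h)) (v' (t - h))) (Ioc a b) :=
      (integrable_dual_apply ((pivot J).comp_memLp' (mz.sub mzh)) mvh).integrableOn
    have e3 : (F b - F (b - h)) - (F a - F (a - h)) = ∫ t in Ioc a b, (p t - p (t - h)) := by
      rw [← intervalIntegral.integral_of_le hab, intervalIntegral.integral_sub (hpii _ _)
        (hpi.comp_sub_right h).intervalIntegrable, intervalIntegral.integral_comp_sub_right,
        ← intervalIntegral.integral_interval_sub_left (hpii 0 b) (hpii 0 a),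
        ← intervalIntegral.integral_interval_sub_left (hpii 0 (b - h)) (hpii 0 (a - h))]
      ring
    -- `(v, z)(t) - (v, z)(t - h) = (v(t) - v(t - h), z(t)) + (z(t) - z(t - h), v(t - h))`
    rw [← mul_add, ← mul_sub, e3, e1, e2, ← integral_add i1 i2]
    congr 1
    refine integral_congr_ae (Filter.Eventually.of_forall fun t => ?_)
    simp only [hp, pivot_apply, map_sub, sub_apply]
    rw [real_inner_comm (J (z' t)) (J (v' (t - h))),
      real_inner_comm (J (z' (t - h))) (J (v' (t - h)))]
    ring
  have key := tendsto_nhds_unique (hR.congr' heq) hL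
  have mem1 : ∀ x ∈ Ioo 0 T, p x = inner ℝ (J (v x)) (J (z x)) := fun x hx => by
    simp only [hp, hv', hz', indicator_of_mem (Ioo_subset_Ioc_self hx), pivot_apply]
  rw [← mem1 b hb, ← mem1 a ha, ← key, ← integral_add
    (integrable_dual_apply mgv mz).integrableOn (integrable_dual_apply mgz mv).integrableOn,
    intervalIntegral.integral_of_le hab]
  refine setIntegral_congr_fun measurableSet_Ioc fun t ht => ?_
  simp only [hgv', hgz', hv', hz', indicator_of_mem (hsub ht)]

end ProductRule

/-! ### Continuous representatives and integration by parts in time -/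

section ContinuousRepresentative

variable {V H : Type*} [NormedAddCommGroup V] [NormedSpace ℝ V] [NormedAddCommGroup H]
  [InnerProductSpace ℝ H]

/-- A set of full measure in `(0, T)` is dense in `[0, T]`. -/
lemma Icc_subset_closure_of_ae {T : ℝ} (hT : 0 < T) {S : Set ℝ}
    (hS : ∀ᵐ t, t ∈ Ioo 0 T → t ∈ S) : Icc 0 T ⊆ closure S := by
  rw [← closure_Ioo hT.ne]
  refine closure_minimal ?_ isClosed_closure
  refine ((Measure.dense_of_ae hS).open_subset_closure_inter isOpen_Ioo).trans (closure_mono ?_)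
  exact fun t ht => ht.2 ht.1

lemma ae_mem_Ioo_of_ae_restrict_Ioc {T : ℝ} {p : ℝ → Prop}
    (h : ∀ᵐ t ∂(volume.restrict (Ioc 0 T)), p t) : ∀ᵐ t, t ∈ Ioo 0 T → p t := by
  rw [← restrict_Ioo_eq_restrict_Ioc] at h
  exact (ae_restrict_iff' measurableSet_Ioo).1 h

lemma MemL2.integrableOn_sq {X : Type*} [NormedAddCommGroup X] {T : ℝ} {v : ℝ → X}
    (h : MemL2 T v) : IntegrableOn (fun t => ‖v t‖ ^ 2) (Ioc 0 T) :=
  (MemLp.norm h).integrable_sq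

/-- The oscillation of `J v` over a time interval `[a, b]` is controlled by the part of the norm of
`v` and of `∂ₜ v` that lives on `[a, b]`. The two values are compared with the value at a time `σ`
at which `‖v σ‖²` does not exceed its mean over `[a, b]`. -/
lemma HasWeakDeriv.exists_norm_sub_le {J : V →L[ℝ] H} {T : ℝ} (hT : 0 < T)
    {v : ℝ → V} {g : ℝ → StrongDual ℝ V} (hv : HasWeakDeriv J T v g) :
    ∃ S ⊆ Ioo 0 T, (∀ᵐ t, t ∈ Ioo 0 T → t ∈ S) ∧ ∀ a ∈ Icc 0 T, ∀ b ∈ Icc 0 T, a < b →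
      ∀ s ∈ S ∩ Icc a b, ∀ t ∈ S ∩ Icc a b,
        ‖J (v t) - J (v s)‖ ≤ 2 * √(2 * ∫ r in a..b, (‖v r‖ ^ 2 + ‖g r‖ ^ 2)) := by
  obtain ⟨S, hST, hS, hE⟩ := hv.exists_inner_sub_inner_eq hT hv
  obtain ⟨C, hC⟩ := hv.exists_pivot_eq hT
  have hC := ae_mem_Ioo_of_ae_restrict_Ioc hC
  set S' := {t | t ∈ S ∧ pivot J (v t) = C + ∫ s in (0 : ℝ)..t, g s} with hS'
  have haeS' : ∀ᵐ t, t ∈ Ioo 0 T → t ∈ S' := by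
    filter_upwards [hS, hC] with t h1 h2 h3 using ⟨h1 h3, h2 h3⟩
  refine ⟨S', fun t ht => hST ht.1, haeS', ?_⟩
  have hgi : ∀ x ∈ Icc 0 T, ∀ y ∈ Icc 0 T, IntervalIntegrable g volume x y := fun x hx y hy =>
    ((intervalIntegrable_iff_integrableOn_Ioc_of_le hT.le).2 hv.mem_deriv.integrableOn).mono_set
      (by rw [uIcc_of_le hT.le]; exact uIcc_subset_Icc hx hy)
  have hgvi : ∀ x ∈ Icc 0 T, ∀ y ∈ Icc 0 T,
      IntervalIntegrable (fun t => g t (v t)) volume x y := fun x hx y hy =>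
    ((intervalIntegrable_iff_integrableOn_Ioc_of_le hT.le).2
      (integrable_dual_apply hv.mem_deriv hv.mem)).mono_set
      (by rw [uIcc_of_le hT.le]; exact uIcc_subset_Icc hx hy)
  -- the energy identities for `v - v s` and `v - v t`, the constants having zero derivative
  have energy : ∀ s ∈ S', ∀ t ∈ S', s ≤ t →
      ‖J (v t) - J (v s)‖ ^ 2 = 2 * ∫ r in s..t, (g r (v r) - g r (v s)) ∧
      ‖J (v t) - J (v s)‖ ^ 2 = 2 * ∫ r in s..t, (g r (v t) - g r (v r)) := by
    intro s hs t ht hst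
    have hs0 := Ioo_subset_Icc_self (hST hs.1)
    have ht0 := Ioo_subset_Icc_self (hST ht.1)
    have h00 : (0 : ℝ) ∈ Icc 0 T := ⟨le_rfl, hT.le⟩
    have h1 := hE s hs.1 t ht.1 hst
    have hw : ∀ w, IntervalIntegrable (fun r => g r w) volume s t := fun w =>
      intervalIntegrable_dual_const (hgi s hs0 t ht0) w
    have h2 : ∀ w, inner ℝ (J (v t)) (J w) - inner ℝ (J (v s)) (J w) = ∫ r in s..t, g r w := by
      intro w
      rw [← pivot_apply, ← pivot_apply, ht.2, hs.2, ← sub_apply, add_sub_add_left_eq_sub,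
        intervalIntegral.integral_interval_sub_left (hgi _ h00 _ ht0) (hgi _ h00 _ hs0),
        ContinuousLinearMap.intervalIntegral_apply (hgi _ hs0 _ ht0)]
    have hgv := hgvi s hs0 t ht0
    have hns := norm_sub_sq_real (J (v t)) (J (v s))
    rw [← real_inner_self_eq_norm_sq (J (v t)), ← real_inner_self_eq_norm_sq (J (v s))] at hns
    rw [intervalIntegral.integral_add hgv hgv] at h1
    have hcomm := real_inner_comm (J (v t)) (J (v s))
    constructor
    · rw [intervalIntegral.integral_sub hgv (hw _), ← h2 (v s), hns]
      linarith
    · rw [intervalIntegral.integral_sub (hw _) hgv, ← h2 (v t), hns]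
      linarith
  intro a ha b hb hab
  have hsub : Ioc a b ⊆ Ioc 0 T := Ioc_subset_Ioc ha.1 hb.2
  have iv : IntegrableOn (fun r => ‖v r‖ ^ 2) (Ioc a b) := hv.mem.integrableOn_sq.mono_set hsub
  have ig : IntegrableOn (fun r => ‖g r‖ ^ 2) (Ioc a b) :=
    hv.mem_deriv.integrableOn_sq.mono_set hsub
  set M := ∫ r in a..b, (‖v r‖ ^ 2 + ‖g r‖ ^ 2) with hM
  have hMsplit : M = (∫ r in Ioc a b, ‖v r‖ ^ 2) + ∫ r in Ioc a b, ‖g r‖ ^ 2 := by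
    rw [hM, intervalIntegral.integral_of_le hab.le, integral_add iv ig]
  have hN : ∀ᵐ t ∂(volume.restrict (Ioc a b)), t ∈ Ioo a b ∧ t ∈ S' := by
    rw [← restrict_Ioo_eq_restrict_Ioc, ae_restrict_iff' measurableSet_Ioo]
    filter_upwards [haeS'] with t h1 h2
    exact ⟨h2, h1 ⟨ha.1.trans_lt h2.1, h2.2.trans_le hb.2⟩⟩
  obtain ⟨σ, hσN, hσle⟩ := exists_notMem_null_le_average (μ := volume.restrict (Ioc a b))
    (by simp [hab]) iv (ae_iff.1 hN)
  rw [mem_ofPred_eq, not_not] at hσN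
  obtain ⟨hσ, hσS⟩ := hσN
  have hσM : (b - a) * ‖v σ‖ ^ 2 ≤ ∫ r in Ioc a b, ‖v r‖ ^ 2 := by
    rw [setAverage_eq, measureReal_def, Real.volume_Ioc, ENNReal.toReal_ofReal (by linarith),
      smul_eq_mul, inv_mul_eq_div, le_div_iff₀ (by linarith)] at hσle
    linarith
  -- the comparison of a value with the value at `σ`
  have bound : ∀ x y : ℝ, a ≤ x → x ≤ y → y ≤ b → ∀ k : ℝ → ℝ,
      (∀ r, |k r| ≤ ‖g r‖ * ‖v r‖ + ‖g r‖ * ‖v σ‖) → 2 * ∫ r in x..y, k r ≤ 2 * M := by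
    intro x y hx hxy hy k hk
    have ib : IntegrableOn (fun r => (‖v r‖ ^ 2 + ‖g r‖ ^ 2) + (‖g r‖ ^ 2 + ‖v σ‖ ^ 2))
        (Ioc a b) := (iv.add ig).add (ig.add (integrableOn_const (by simp)))
    have hkb : ∀ r, |k r| ≤ ((‖v r‖ ^ 2 + ‖g r‖ ^ 2) + (‖g r‖ ^ 2 + ‖v σ‖ ^ 2)) / 2 := by
      intro r
      have h1 := two_mul_le_add_sq ‖g r‖ ‖v r‖
      have h2 := two_mul_le_add_sq ‖g r‖ ‖v σ‖
      linarith [hk r]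
    have h3 : ∫ r in x..y, k r
        ≤ ∫ r in Ioc a b, ((‖v r‖ ^ 2 + ‖g r‖ ^ 2) + (‖g r‖ ^ 2 + ‖v σ‖ ^ 2)) / 2 := by
      refine (le_abs_self _).trans ?_
      rw [intervalIntegral.integral_of_le hxy, ← Real.norm_eq_abs]
      refine (norm_integral_le_of_norm_le
        (IntegrableOn.mono_set (ib.div_const 2) (Ioc_subset_Ioc hx hy))
        (Filter.Eventually.of_forall hkb)).trans ?_
      refine setIntegral_mono_set (ib.div_const 2)
        (Filter.Eventually.of_forall fun r => by positivity)
        (Ioc_subset_Ioc hx hy).eventuallyLE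
    have h4 : ∫ r in Ioc a b, ((‖v r‖ ^ 2 + ‖g r‖ ^ 2) + (‖g r‖ ^ 2 + ‖v σ‖ ^ 2)) / 2
        = (((∫ r in Ioc a b, ‖v r‖ ^ 2) + ∫ r in Ioc a b, ‖g r‖ ^ 2)
          + ((∫ r in Ioc a b, ‖g r‖ ^ 2) + (b - a) * ‖v σ‖ ^ 2)) / 2 := by
      have ic : IntegrableOn (fun _ : ℝ => ‖v σ‖ ^ 2) (Ioc a b) := integrableOn_const (by simp)
      have i1 : IntegrableOn (fun r => ‖v r‖ ^ 2 + ‖g r‖ ^ 2) (Ioc a b) := iv.add ig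
      have i2 : IntegrableOn (fun r => ‖g r‖ ^ 2 + ‖v σ‖ ^ 2) (Ioc a b) := ig.add ic
      rw [integral_div, integral_add i1 i2, integral_add iv ig, integral_add ig ic,
        setIntegral_const, measureReal_def, Real.volume_Ioc, ENNReal.toReal_ofReal (by linarith),
        smul_eq_mul]
    have h5 : 0 ≤ ∫ r in Ioc a b, ‖v r‖ ^ 2 := integral_nonneg fun r => by positivity
    linarith
  -- the two energy identities serve times after and before `σ`, so that only `v σ` enters
  have near : ∀ t ∈ S' ∩ Icc a b, ‖J (v t) - J (v σ)‖ ≤ √(2 * M) := by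
    rintro t ⟨htS, hta, htb⟩
    refine Real.le_sqrt_of_sq_le ?_
    have hop : ∀ r w, |g r w| ≤ ‖g r‖ * ‖w‖ := fun r w => (g r).le_opNorm w
    rcases le_total σ t with h | h
    · rw [(energy σ hσS t htS h).1]
      refine bound σ t hσ.1.le h htb _ fun r => ?_
      exact (abs_sub _ _).trans (add_le_add (hop _ _) (hop _ _))
    · rw [norm_sub_rev, (energy t htS σ hσS h).2]
      refine bound t σ hta h hσ.2.le _ fun r => ?_
      rw [abs_sub_comm]
      exact (abs_sub _ _).trans (add_le_add (hop _ _) (hop _ _))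
  intro s hs t ht
  calc ‖J (v t) - J (v s)‖ ≤ ‖J (v t) - J (v σ)‖ + ‖J (v σ) - J (v s)‖ :=
        norm_sub_le_norm_sub_add_norm_sub _ _ _
    _ ≤ √(2 * M) + √(2 * M) := add_le_add (near t ht) (by rw [norm_sub_rev]; exact near s hs)
    _ = 2 * √(2 * M) := by ring

/-- The embedding of `{v ∈ L²(0,T; V) : ∂ₜ v ∈ L²(0,T; V*)}` into `C([0,T]; H)`. -/
lemma HasWeakDeriv.exists_continuousOn [CompleteSpace H] {J : V →L[ℝ] H} {T : ℝ} (hT : 0 < T)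
    {v : ℝ → V} {g : ℝ → StrongDual ℝ V} (hv : HasWeakDeriv J T v g) :
    ∃ c : ℝ → H, ContinuousOn c (Icc 0 T) ∧ ∀ᵐ t ∂(volume.restrict (Icc 0 T)), c t = J (v t) := by
  obtain ⟨S, hST, hS, hosc⟩ := hv.exists_norm_sub_le hT
  have hcl := Icc_subset_closure_of_ae hT hS
  have hmi : IntervalIntegrable (fun r => ‖v r‖ ^ 2 + ‖g r‖ ^ 2) volume 0 T :=
    (intervalIntegrable_iff_integrableOn_Ioc_of_le hT.le).2
      (hv.mem.integrableOn_sq.add hv.mem_deriv.integrableOn_sq)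
  have hmi' : ∀ x ∈ Icc 0 T, IntervalIntegrable (fun r => ‖v r‖ ^ 2 + ‖g r‖ ^ 2) volume 0 x :=
    fun x hx => hmi.mono_set (by
      rw [uIcc_of_le hT.le]; exact uIcc_subset_Icc ⟨le_rfl, hT.le⟩ hx)
  have hmc := intervalIntegral.continuousOn_primitive_interval' hmi left_mem_uIcc
  rw [uIcc_of_le hT.le] at hmc
  have hlim : ∀ x ∈ Icc 0 T, ∃ y, Filter.Tendsto (fun t => J (v t)) (𝓝[S] x) (𝓝 y) := by
    intro x hx
    have hne : (𝓝[S] x).NeBot := mem_closure_iff_nhdsWithin_neBot.1 (hcl hx)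
    refine CompleteSpace.complete (Metric.cauchy_iff.2 ⟨hne.map _, fun e he => ?_⟩)
    obtain ⟨δ, hδ, hδ'⟩ := Metric.continuousWithinAt_iff.1 (hmc x hx) (e ^ 2 / 32) (by positivity)
    set a := max 0 (x - δ / 2) with ha
    set b := min T (x + δ / 2) with hb
    have hab : a < b := by
      rw [lt_min_iff, max_lt_iff, max_lt_iff]
      exact ⟨⟨hT, by linarith [hx.2]⟩, by linarith [hx.1], by linarith⟩
    have ha0 : a ∈ Icc 0 T := ⟨le_max_left _ _, hab.le.trans (min_le_left _ _)⟩
    have hb0 : b ∈ Icc 0 T := ⟨(le_max_left _ _).trans hab.le, min_le_left _ _⟩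
    have hxa : a ≤ x := max_le hx.1 (by linarith)
    have hxb : x ≤ b := le_min hx.2 (by linarith)
    have da := hδ' ha0 (by
      rw [Real.dist_eq, abs_sub_lt_iff]
      have := le_max_right 0 (x - δ / 2)
      constructor <;> linarith)
    have db := hδ' hb0 (by
      rw [Real.dist_eq, abs_sub_lt_iff]
      have := min_le_right T (x + δ / 2)
      constructor <;> linarith)
    rw [Real.dist_eq, abs_sub_lt_iff] at da db
    have hM : ∫ r in a..b, (‖v r‖ ^ 2 + ‖g r‖ ^ 2) < e ^ 2 / 16 := by
      rw [← intervalIntegral.integral_interval_sub_left (hmi' b hb0) (hmi' a ha0)]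
      linarith [da.2, db.1]
    have hsq : 2 * √(2 * ∫ r in a..b, (‖v r‖ ^ 2 + ‖g r‖ ^ 2)) < e := by
      have : √(2 * ∫ r in a..b, (‖v r‖ ^ 2 + ‖g r‖ ^ 2)) < e / 2 := by
        rw [Real.sqrt_lt' (by positivity)]
        nlinarith
      linarith
    refine ⟨(fun t => J (v t)) '' (S ∩ Icc a b), ?_, ?_⟩
    · refine Filter.image_mem_map (Filter.inter_mem self_mem_nhdsWithin ?_)
      refine mem_nhdsWithin.2 ⟨Ioo (x - δ / 2) (x + δ / 2), isOpen_Ioo,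
        ⟨by linarith, by linarith⟩, fun t ht => ?_⟩
      have ht0 := hST ht.2
      exact ⟨max_le ht0.1.le ht.1.1.le, le_min ht0.2.le ht.1.2.le⟩
    · rintro _ ⟨t, ht, rfl⟩ _ ⟨s, hs, rfl⟩
      rw [dist_eq_norm]
      exact (hosc a ha0 b hb0 hab s hs t ht).trans_lt hsq
  refine ⟨extendFrom S (fun t => J (v t)), continuousOn_extendFrom hcl hlim, ?_⟩
  rw [← restrict_Ioo_eq_restrict_Icc, ae_restrict_iff' measurableSet_Ioo]
  filter_upwards [hS] with t ht hm
  obtain ⟨y, hy⟩ := hlim t (Ioo_subset_Icc_self hm)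
  have hy' : y = J (v t) := tendsto_nhds_unique (hy.mono_left (pure_le_nhdsWithin (ht hm)))
    (tendsto_pure_nhds _ _)
  rw [extendFrom_eq (hcl (Ioo_subset_Icc_self hm)) hy, hy']

/-- Functions that are continuous on `[0, T]` and agree almost everywhere agree on `[0, T]`. -/
lemma eqOn_Icc_of_ae_eq {X : Type*} [TopologicalSpace X] [T2Space X] {T : ℝ} (hT : 0 < T)
    {c c' : ℝ → X} (hc : ContinuousOn c (Icc 0 T)) (hc' : ContinuousOn c' (Icc 0 T))
    (h : ∀ᵐ t ∂(volume.restrict (Icc 0 T)), c t = c' t) : EqOn c c' (Icc 0 T) := by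
  rw [← restrict_Ioc_eq_restrict_Icc] at h
  have h' := ae_mem_Ioo_of_ae_restrict_Ioc h
  have hae : ∀ᵐ t, t ∈ Ioo 0 T → t ∈ {t | t ∈ Ioo 0 T ∧ c t = c' t} := by
    filter_upwards [h'] with t ht hm using ⟨hm, ht hm⟩
  exact EqOn.of_subset_closure (s := {t | t ∈ Ioo 0 T ∧ c t = c' t}) (fun t ht => ht.2) hc hc'
    (fun t ht => Ioo_subset_Icc_self ht.1) (Icc_subset_closure_of_ae hT hae)

/-- Integration by parts in time for functions with weak time derivatives in `L²(0,T; V*)`; the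
boundary values are those of the continuous representatives. -/
lemma HasWeakDeriv.integral_add_eq {J : V →L[ℝ] H} {T : ℝ} (hT : 0 < T)
    {v z : ℝ → V} {gv gz : ℝ → StrongDual ℝ V} (hv : HasWeakDeriv J T v gv)
    (hz : HasWeakDeriv J T z gz) {cv cz : ℝ → H} (hcv : ContinuousOn cv (Icc 0 T))
    (hcz : ContinuousOn cz (Icc 0 T)) (hv' : ∀ᵐ t ∂(volume.restrict (Icc 0 T)), cv t = J (v t))
    (hz' : ∀ᵐ t ∂(volume.restrict (Icc 0 T)), cz t = J (z t)) :
    ∫ t in (0 : ℝ)..T, (gv t (z t) + gz t (v t))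
      = inner ℝ (cv T) (cz T) - inner ℝ (cv 0) (cz 0) := by
  obtain ⟨S, hST, hS, hE⟩ := hv.exists_inner_sub_inner_eq hT hz
  rw [← restrict_Ioc_eq_restrict_Icc] at hv' hz'
  set S' := {t | t ∈ S ∧ cv t = J (v t) ∧ cz t = J (z t)} with hS'
  have hae : ∀ᵐ t, t ∈ Ioo 0 T → t ∈ S' := by
    filter_upwards [hS, ae_mem_Ioo_of_ae_restrict_Ioc hv', ae_mem_Ioo_of_ae_restrict_Ioc hz']
      with t h1 h2 h3 hm using ⟨h1 hm, h2 hm, h3 hm⟩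
  have hcl := Icc_subset_closure_of_ae hT hae
  have hki : IntervalIntegrable (fun t => gv t (z t) + gz t (v t)) volume 0 T :=
    (intervalIntegrable_iff_integrableOn_Ioc_of_le hT.le).2
      ((integrable_dual_apply hv.mem_deriv hz.mem).add (integrable_dual_apply hz.mem_deriv hv.mem))
  have h00 : (0 : ℝ) ∈ Icc 0 T := ⟨le_rfl, hT.le⟩
  have hTT : T ∈ Icc 0 T := ⟨hT.le, le_rfl⟩
  have hki' : ∀ x ∈ Icc 0 T,
      IntervalIntegrable (fun t => gv t (z t) + gz t (v t)) volume 0 x := fun x hx =>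
    hki.mono_set (by rw [uIcc_of_le hT.le]; exact uIcc_subset_Icc h00 hx)
  have hpc := intervalIntegral.continuousOn_primitive_interval' hki left_mem_uIcc
  rw [uIcc_of_le hT.le] at hpc
  set D : ℝ → ℝ := fun t =>
    inner ℝ (cv t) (cz t) - ∫ r in (0 : ℝ)..t, (gv r (z r) + gz r (v r)) with hD
  have hDc : ContinuousOn D (Icc 0 T) := (hcv.inner hcz).sub hpc
  have hS'T : S' ⊆ Icc 0 T := fun t ht => Ioo_subset_Icc_self (hST ht.1)
  have hDS : ∀ a ∈ S', ∀ b ∈ S', a ≤ b → D a = D b := by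
    intro a ha b hb hab
    have h1 := hE a ha.1 b hb.1 hab
    rw [← intervalIntegral.integral_interval_sub_left (hki' b (hS'T hb)) (hki' a (hS'T ha)),
      ← ha.2.1, ← ha.2.2, ← hb.2.1, ← hb.2.2] at h1
    simp only [hD]
    linarith
  obtain ⟨x, hx⟩ : S'.Nonempty := closure_nonempty_iff.1 ⟨0, hcl h00⟩
  have hconst : EqOn D (fun _ => D x) (Icc 0 T) := by
    refine EqOn.of_subset_closure (s := S') (fun t ht => ?_) hDc continuousOn_const hS'T hcl
    rcases le_total t x with h | h
    · exact hDS t ht x hx h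
    · exact (hDS x hx t ht h).symm
  have h1 : D T = D 0 := (hconst hTT).trans (hconst h00).symm
  simp only [hD, intervalIntegral.integral_same, sub_zero] at h1
  linarith

end ContinuousRepresentative

/-! ### The double well potential -/

lemma hasDerivAt_of_Iic_of_Ici {f f₁ f₂ : ℝ → ℝ} {a d : ℝ} (h₁ : HasDerivAt f₁ d a)
    (h₂ : HasDerivAt f₂ d a) (e₁ : f =ᶠ[𝓝[≤] a] f₁) (e₂ : f =ᶠ[𝓝[≥] a] f₂) :
    HasDerivAt f d a := by
  have h1 : HasDerivWithinAt f d (Iic a) a :=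
    h₁.hasDerivWithinAt.congr_of_eventuallyEq e₁ (e₁.self_of_nhdsWithin self_mem_Iic)
  have h2 : HasDerivWithinAt f d (Ici a) a :=
    h₂.hasDerivWithinAt.congr_of_eventuallyEq e₂ (e₂.self_of_nhdsWithin self_mem_Ici)
  have := h1.union h2
  rwa [Iic_union_Ici, hasDerivWithinAt_univ] at this

/-- The projection onto `[-1, 1]`; in terms of it the first and second derivative of the truncated
double well are given by a single formula. -/
noncomputable def clamp (s : ℝ) : ℝ := max (-1) (min 1 s)

lemma clamp_of_le {s : ℝ} (h : s ≤ -1) : clamp s = -1 := by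
  rw [clamp, min_eq_right (by linarith), max_eq_left h]

lemma clamp_of_ge {s : ℝ} (h : 1 ≤ s) : clamp s = 1 := by
  rw [clamp, min_eq_left h, max_eq_right (by norm_num)]

lemma clamp_of_mem {s : ℝ} (h : s ∈ Icc (-1 : ℝ) 1) : clamp s = s := by
  rw [clamp, min_eq_right h.2, max_eq_right h.1]

lemma clamp_mem (s : ℝ) : clamp s ∈ Icc (-1 : ℝ) 1 :=
  ⟨le_max_left _ _, max_le (by norm_num) (min_le_left _ _)⟩

/-- Differentiation of a function given by three formulas on `(-∞, -1]`, `[-1, 1]`, `[1, ∞)`. -/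
lemma hasDerivAt_of_three_pieces {f f₁ f₂ f₃ : ℝ → ℝ} {d₁ d₂ d₃ : ℝ} {s d : ℝ}
    (e₁ : ∀ x ≤ -1, f x = f₁ x) (e₂ : ∀ x ∈ Icc (-1 : ℝ) 1, f x = f₂ x)
    (e₃ : ∀ x, 1 ≤ x → f x = f₃ x)
    (h₁ : HasDerivAt f₁ d₁ s) (h₂ : HasDerivAt f₂ d₂ s) (h₃ : HasDerivAt f₃ d₃ s)
    (k₁ : s ≤ -1 → d₁ = d) (k₂ : s ∈ Icc (-1 : ℝ) 1 → d₂ = d) (k₃ : 1 ≤ s → d₃ = d) :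
    HasDerivAt f d s := by
  rcases lt_trichotomy s (-1) with hs | rfl | hs
  · rw [← k₁ hs.le]
    refine h₁.congr_of_eventuallyEq ?_
    filter_upwards [Iio_mem_nhds hs] with x hx using e₁ x (le_of_lt hx)
  · refine hasDerivAt_of_Iic_of_Ici (k₁ le_rfl ▸ h₁) (k₂ (by norm_num) ▸ h₂) ?_ ?_
    · filter_upwards [self_mem_nhdsWithin] with x hx using e₁ x hx
    · filter_upwards [Icc_mem_nhdsGE (show (-1 : ℝ) < 1 by norm_num)] with x hx using e₂ x hx
  rcases lt_trichotomy s 1 with hs' | rfl | hs'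
  · rw [← k₂ ⟨hs.le, hs'.le⟩]
    refine h₂.congr_of_eventuallyEq ?_
    filter_upwards [Ioo_mem_nhds hs hs'] with x hx using e₂ x (Ioo_subset_Icc_self hx)
  · refine hasDerivAt_of_Iic_of_Ici (k₂ (by norm_num) ▸ h₂) (k₃ le_rfl ▸ h₃) ?_ ?_
    · filter_upwards [Icc_mem_nhdsLE (show (-1 : ℝ) < 1 by norm_num)] with x hx using e₂ x hx
    · filter_upwards [self_mem_nhdsWithin] with x hx using e₃ x hx
  · rw [← k₃ hs'.le]
    refine h₃.congr_of_eventuallyEq ?_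
    filter_upwards [Ioi_mem_nhds hs'] with x hx using e₃ x (le_of_lt hx)

lemma hasDerivAt_psi (s : ℝ) : HasDerivAt psi (clamp s ^ 3 - 3 * clamp s + 2 * s) s := by
  have h₁ : HasDerivAt (fun x : ℝ => (x + 1) ^ 2) (2 * (s + 1)) s := by
    exact (((hasDerivAt_id s).add_const 1).pow 2).congr_deriv (by simp)
  have h₂ : HasDerivAt (fun x : ℝ => (x ^ 2 - 1) ^ 2 / 4) (s * (s ^ 2 - 1)) s := by
    refine ((((hasDerivAt_id s).pow 2).sub_const 1).pow 2).div_const 4 |>.congr_deriv ?_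
    simp
    ring
  have h₃ : HasDerivAt (fun x : ℝ => (x - 1) ^ 2) (2 * (s - 1)) s := by
    exact (((hasDerivAt_id s).sub_const 1).pow 2).congr_deriv (by simp)
  refine hasDerivAt_of_three_pieces ?_ ?_ ?_ h₁ h₂ h₃ ?_ ?_ ?_
  · intro x hx
    rcases hx.lt_or_eq with h | rfl
    · simp [psi, h]
    · norm_num [psi]
  · intro x hx
    simp [psi, not_lt.2 hx.1, hx.2]
  · intro x hx
    rcases hx.lt_or_eq with h | rfl
    · simp [psi, not_lt.2 (show (-1 : ℝ) ≤ x by linarith), not_le.2 h]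
    · norm_num [psi]
  · intro hs
    rw [clamp_of_le hs]
    ring
  · intro hs
    rw [clamp_of_mem hs]
    ring
  · intro hs
    rw [clamp_of_ge hs]
    ring

lemma deriv_psi : deriv psi = fun s => clamp s ^ 3 - 3 * clamp s + 2 * s :=
  funext fun s => (hasDerivAt_psi s).deriv

lemma hasDerivAt_deriv_psi (s : ℝ) : HasDerivAt (deriv psi) (3 * clamp s ^ 2 - 1) s := by
  have h₁ : HasDerivAt (fun x : ℝ => 2 + 2 * x) 2 s := by
    simpa using ((hasDerivAt_id s).const_mul 2).const_add 2
  have h₂ : HasDerivAt (fun x : ℝ => x ^ 3 - x) (3 * s ^ 2 - 1) s := by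
    exact (((hasDerivAt_id s).pow 3).sub (hasDerivAt_id s)).congr_deriv (by simp)
  have h₃ : HasDerivAt (fun x : ℝ => -2 + 2 * x) 2 s := by
    simpa using ((hasDerivAt_id s).const_mul 2).const_add (-2)
  rw [deriv_psi]
  refine hasDerivAt_of_three_pieces ?_ ?_ ?_ h₁ h₂ h₃ ?_ ?_ ?_
  · intro x hx
    simp only [clamp_of_le hx]
    ring
  · intro x hx
    simp only [clamp_of_mem hx]
    ring
  · intro x hx
    simp only [clamp_of_ge hx]
    ring
  · intro hs
    rw [clamp_of_le hs]
    norm_num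
  · intro hs
    rw [clamp_of_mem hs]
  · intro hs
    rw [clamp_of_ge hs]
    norm_num

lemma deriv_deriv_psi : deriv (deriv psi) = fun s => 3 * clamp s ^ 2 - 1 :=
  funext fun s => (hasDerivAt_deriv_psi s).deriv

lemma continuous_deriv_deriv_psi : Continuous (deriv (deriv psi)) := by
  rw [deriv_deriv_psi]
  unfold clamp
  fun_prop

lemma lipschitzWith_deriv_psi : LipschitzWith 2 (deriv psi) := by
  refine lipschitzWith_of_nnnorm_deriv_le (fun s => (hasDerivAt_deriv_psi s).differentiableAt)
    fun s => ?_
  rw [deriv_deriv_psi, ← NNReal.coe_le_coe, coe_nnnorm, Real.norm_eq_abs, NNReal.coe_ofNat, abs_le]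
  have h := clamp_mem s
  constructor <;> nlinarith [h.1, h.2, sq_nonneg (clamp s)]

lemma deriv_psi_zero : deriv psi 0 = 0 := by
  rw [deriv_psi]
  simp [clamp_of_mem (show (0 : ℝ) ∈ Icc (-1 : ℝ) 1 by norm_num)]

/-- The defining property of the mean-value linearization. -/
lemma meanLin_psi_mul_sub (a b : ℝ) : meanLin psi a b * (a - b) = deriv psi a - deriv psi b := by
  have hd : ∀ s ∈ uIcc (0 : ℝ) 1, HasDerivAt (fun s => deriv psi (s * a + (1 - s) * b))
      (deriv (deriv psi) (s * a + (1 - s) * b) * (a - b)) s := by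
    intro s _
    have h1 : HasDerivAt (fun s : ℝ => s * a + (1 - s) * b) (a - b) s := by
      refine (((hasDerivAt_id s).mul_const a).add
        (((hasDerivAt_id s).const_sub 1).mul_const b)).congr_deriv ?_
      ring
    exact (hasDerivAt_deriv_psi _).differentiableAt.hasDerivAt.comp s h1
  have hc : Continuous fun s => deriv (deriv psi) (s * a + (1 - s) * b) * (a - b) :=
    (continuous_deriv_deriv_psi.comp (by fun_prop)).mul continuous_const
  have := intervalIntegral.integral_eq_sub_of_hasDerivAt hd (hc.intervalIntegrable _ _)
  rw [intervalIntegral.integral_mul_const] at this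
  simpa [meanLin] using this

/-! ### The nonlinear terms on `L²(Ω)` -/

variable {d : ℕ} {Ω : Set (EuclideanSpace ℝ (Fin d))}

/-- The superposition operator `a ↦ ψ'(a)` on `L²(Ω)`. -/
noncomputable def psiDeriv (a : L2 Ω) : L2 Ω := lipschitzWith_deriv_psi.compLp deriv_psi_zero a

lemma continuous_psiDeriv : Continuous (psiDeriv : L2 Ω → L2 Ω) :=
  lipschitzWith_deriv_psi.continuous_compLp deriv_psi_zero

lemma norm_psiDeriv_le (a : L2 Ω) : ‖psiDeriv a‖ ≤ 2 * ‖a‖ :=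
  lipschitzWith_deriv_psi.norm_compLp_le deriv_psi_zero a

lemma compPair_deriv_psi (a b : L2 Ω) : compPair (deriv psi) a b = inner ℝ (psiDeriv a) b := by
  rw [L2.inner_def]
  refine integral_congr_ae ?_
  filter_upwards [lipschitzWith_deriv_psi.coeFn_compLp deriv_psi_zero a] with x hx
  rw [psiDeriv, hx, Function.comp_apply, real_inner_eq_re_inner]
  simp [mul_comm]

lemma meanLinPair_psi_sub (a b z : L2 Ω) :
    meanLinPair psi a b z (a - b) = inner ℝ (psiDeriv a) z - inner ℝ (psiDeriv b) z := by
  rw [← inner_sub_left, L2.inner_def]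
  refine integral_congr_ae ?_
  filter_upwards [lipschitzWith_deriv_psi.coeFn_compLp deriv_psi_zero a,
    lipschitzWith_deriv_psi.coeFn_compLp deriv_psi_zero b, Lp.coeFn_sub a b,
    Lp.coeFn_sub (psiDeriv a) (psiDeriv b)] with x h1 h2 h3 h4
  rw [h4, h3, Pi.sub_apply, Pi.sub_apply, psiDeriv, psiDeriv, h1, h2, Function.comp_apply,
    Function.comp_apply, ← meanLin_psi_mul_sub]
  simp
  ring

lemma MemL2.psiDeriv {T : ℝ} {v : ℝ → L2 Ω} (hv : MemL2 T v) :
    MemL2 T (fun t => psiDeriv (v t)) := by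
  refine MemLp.of_le_mul (c := 2) hv (continuous_psiDeriv.comp_aestronglyMeasurable hv.1) ?_
  exact Filter.Eventually.of_forall fun t => norm_psiDeriv_le _

/-! ### Functions with values in `H¹(Ω)` -/

/-- The embedding `H¹(Ω) → L²(Ω)` as a continuous linear map. -/
noncomputable def valL (Ω : Set (EuclideanSpace ℝ (Fin d))) : H1 Ω →L[ℝ] L2 Ω :=
  (WithLp.fstL 2 ℝ (L2 Ω) (L2Vec Ω)).comp (H1 Ω).subtypeL

/-- The weak gradient as a continuous linear map. -/
noncomputable def gradL (Ω : Set (EuclideanSpace ℝ (Fin d))) : H1 Ω →L[ℝ] L2Vec Ω :=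
  (WithLp.sndL 2 ℝ (L2 Ω) (L2Vec Ω)).comp (H1 Ω).subtypeL

lemma valL_apply (v : H1 Ω) : valL Ω v = val v := rfl

lemma val_sub (v w : H1 Ω) : val (v - w) = val v - val w := map_sub (valL Ω) v w

lemma val_smul (c : ℝ) (v : H1 Ω) : val (c • v) = c • val v := map_smul (valL Ω) c v

lemma grad_sub (v w : H1 Ω) : grad (v - w) = grad v - grad w := map_sub (gradL Ω) v w

lemma MemL2.val {T : ℝ} {v : ℝ → H1 Ω} (h : MemL2 T v) : MemL2 T (fun t => val (v t)) :=
  (valL Ω).comp_memLp' h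

lemma MemL2.grad {T : ℝ} {v : ℝ → H1 Ω} (h : MemL2 T v) : MemL2 T (fun t => grad (v t)) :=
  (gradL Ω).comp_memLp' h

lemma MemL2.intervalIntegrable_inner {X : Type*} [NormedAddCommGroup X] [InnerProductSpace ℝ X]
    {T : ℝ} (hT : 0 < T) {v w : ℝ → X} (hv : MemL2 T v) (hw : MemL2 T w) :
    IntervalIntegrable (fun t => (inner ℝ (v t) (w t) : ℝ)) volume 0 T :=
  (intervalIntegrable_iff_integrableOn_Ioc_of_le hT.le).2
    (integrable_dual_apply ((innerSL ℝ : X →L[ℝ] X →L[ℝ] ℝ).comp_memLp' hv) hw)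

lemma MemL2.intervalIntegrable_apply {V : Type*} [NormedAddCommGroup V] [NormedSpace ℝ V]
    {T : ℝ} (hT : 0 < T) {g : ℝ → StrongDual ℝ V} {w : ℝ → V} (hg : MemL2 T g) (hw : MemL2 T w) :
    IntervalIntegrable (fun t => g t (w t)) volume 0 T :=
  (intervalIntegrable_iff_integrableOn_Ioc_of_le hT.le).2 (integrable_dual_apply hg hw)

lemma MemL2.of_continuousOn {X : Type*} [NormedAddCommGroup X] {T : ℝ} {v : ℝ → X}
    (h : ContinuousOn v (Icc 0 T)) : MemL2 T v := by
  obtain ⟨C, hC⟩ := isCompact_Icc.exists_bound_of_continuousOn h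
  refine MemLp.of_bound (C := C) ?_ ?_
  · exact (h.aestronglyMeasurable_of_isCompact isCompact_Icc measurableSet_Icc).mono_set
      Ioc_subset_Icc_self
  · rw [ae_restrict_iff' measurableSet_Ioc]
    exact Filter.Eventually.of_forall fun s hs => hC s (Ioc_subset_Icc_self hs)

/-- A continuous function that is differentiable off a countable set, with a square integrable
derivative, has this derivative as its weak time derivative. -/
lemma hasWeakDeriv_of_hasDerivAt {V H : Type*} [NormedAddCommGroup V] [NormedSpace ℝ V]
    [NormedAddCommGroup H] [InnerProductSpace ℝ H] (J : V →L[ℝ] H) {T : ℝ} (hT : 0 < T)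
    {v v' : ℝ → V} {C : Set ℝ} (hC : C.Countable) (hv : ContinuousOn v (Icc 0 T))
    (hd : ∀ s ∈ Ioo 0 T \ C, HasDerivAt v (v' s) s) (hv' : MemL2 T v') :
    HasWeakDeriv J T v (fun s => pivot J (v' s)) := by
  have hmI : MemL2 T v := MemL2.of_continuousOn hv
  refine ⟨hmI, (pivot J).comp_memLp' hv', fun φ hφ e => ?_⟩
  have hφc : Continuous φ := hφ.smooth.continuous
  have hφ' : Continuous (deriv φ) := hφ.smooth.continuous_deriv (by simp)
  set ℓ : V →L[ℝ] ℝ := (pivot J).flip e with hℓ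
  have hℓI : IntervalIntegrable (fun s => ℓ (v s) * deriv φ s) volume 0 T :=
    IntervalIntegrable.mul_continuousOn ((intervalIntegrable_iff_integrableOn_Ioc_of_le hT.le).2
      (ℓ.integrable_comp hmI.integrableOn)) hφ'.continuousOn
  have hℓD : IntervalIntegrable (fun s => ℓ (v' s) * φ s) volume 0 T :=
    IntervalIntegrable.mul_continuousOn ((intervalIntegrable_iff_integrableOn_Ioc_of_le hT.le).2
      (ℓ.integrable_comp hv'.integrableOn)) hφc.continuousOn
  have hFc : ContinuousOn (fun s => ℓ (v s) * φ s) (Icc 0 T) :=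
    (ℓ.continuous.comp_continuousOn hv).mul hφc.continuousOn
  have hFd : ∀ s ∈ Ioo 0 T \ C,
      HasDerivAt (fun s => ℓ (v s) * φ s) (ℓ (v' s) * φ s + ℓ (v s) * deriv φ s) s := fun s hs =>
    (ℓ.hasFDerivAt.comp_hasDerivAt s (hd s hs)).mul
      (hφ.smooth.differentiable (by simp) s).hasDerivAt
  have hFTC := integral_eq_of_hasDerivAt_off_countable_of_le _ _ hT.le hC hFc hFd (hℓD.add hℓI)
  rw [intervalIntegral.integral_add hℓD hℓI, hφ.eq_zero_left, hφ.eq_zero_right] at hFTC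
  simp only [mul_zero, sub_zero] at hFTC
  exact eq_neg_of_add_eq_zero_right hFTC

lemma IsInW.hasWeakDeriv {T : ℝ} {v : ℝ → H1 Ω} {g : ℝ → H1Dual Ω} (h : IsInW T v g) :
    HasWeakDeriv (valL Ω) T v g :=
  ⟨h.mem, h.mem_deriv, h.weak⟩

/-- As soon as a continuous representative exists, `trace` is one. -/
lemma isContRep_trace {T : ℝ} {v : ℝ → H1 Ω} (h : ∃ c, IsContRep T v c) :
    IsContRep T v (trace T v) := by
  have : trace T v = h.choose := by
    funext t
    simp only [trace, dif_pos h]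
  rw [this]
  exact h.choose_spec

lemma IsInW.isContRep_trace {T : ℝ} (hT : 0 < T) {v : ℝ → H1 Ω} {g : ℝ → H1Dual Ω}
    (h : IsInW T v g) : IsContRep T v (trace T v) :=
  AllenCahn.isContRep_trace (h.hasWeakDeriv.exists_continuousOn hT)

/-! ### The piecewise linear reconstruction in time -/

section Partition

variable {T : ℝ} {N : ℕ} {t : ℕ → ℝ}

lemma IsPartition.lt_of_lt (ht : IsPartition T N t) {j k : ℕ} (hjk : j < k) (hk : k ≤ N) :
    t j < t k := by
  induction k, hjk using Nat.le_induction with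
  | base => exact ht.lt j (by omega)
  | succ k hk' ih => exact (ih (by omega)).trans (ht.lt k (by omega))

lemma IsPartition.le_of_le (ht : IsPartition T N t) {j k : ℕ} (hjk : j ≤ k) (hk : k ≤ N) :
    t j ≤ t k := by
  rcases hjk.eq_or_lt with rfl | h
  · exact le_rfl
  · exact (ht.lt_of_lt h hk).le

lemma IsPartition.mem_Icc (ht : IsPartition T N t) {k : ℕ} (hk : k ≤ N) : t k ∈ Icc 0 T := by
  rw [← ht.zero, ← ht.last]
  exact ⟨ht.le_of_le (Nat.zero_le k) hk, ht.le_of_le hk le_rfl⟩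

lemma IsPartition.tau_pos (ht : IsPartition T N t) {k : ℕ} (hk : k < N) : 0 < tau t (k + 1) := by
  simpa [tau] using ht.lt k hk

lemma IsPartition.exists_mem_Ioc (ht : IsPartition T N t) {s : ℝ} (hs : s ∈ Ioc 0 T) :
    ∃ k < N, s ∈ Ioc (t k) (t (k + 1)) := by
  have key : ∀ n ≤ N, s ≤ t n → ∃ k < n, s ∈ Ioc (t k) (t (k + 1)) := by
    intro n hn hsn
    induction n with
    | zero => rw [ht.zero] at hsn; exact absurd hsn (not_le.2 hs.1)
    | succ n ih =>
      rcases le_or_gt s (t n) with h | h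
      · obtain ⟨k, hk, hks⟩ := ih (by omega) h
        exact ⟨k, by omega, hks⟩
      · exact ⟨n, by omega, h, hsn⟩
  exact key N le_rfl (by rw [ht.last]; exact hs.2)

lemma IsPartition.intervalIntegrable (ht : IsPartition T N t) {X : Type*} [NormedAddCommGroup X]
    {F : ℝ → X} (hF : IntervalIntegrable F volume 0 T) {k : ℕ} (hk : k < N) :
    IntervalIntegrable F volume (t k) (t (k + 1)) := by
  refine hF.mono_set ?_
  have h1 := ht.mem_Icc hk.le
  have h2 := ht.mem_Icc hk
  exact (uIcc_subset_Icc h1 h2).trans Icc_subset_uIcc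

lemma IsPartition.sum_integral (ht : IsPartition T N t) {F : ℝ → ℝ}
    (hF : IntervalIntegrable F volume 0 T) :
    ∑ k ∈ Finset.range N, ∫ s in (t k)..(t (k + 1)), F s = ∫ s in (0 : ℝ)..T, F s := by
  rw [intervalIntegral.sum_integral_adjacent_intervals (a := t)
    fun k hk => ht.intervalIntegrable hF hk,
    ht.zero, ht.last]

lemma hat_left {k : ℕ} (hk : k < N) {s : ℝ}
    (hs : s ∈ Icc (t k) (t (k + 1))) : hat N t k s = (t (k + 1) - s) / tau t (k + 1) := by
  rw [hat, if_pos ⟨hk, hs⟩]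

lemma IsPartition.hat_right (ht : IsPartition T N t) {k : ℕ} (hk : k < N) {s : ℝ}
    (hs : s ∈ Icc (t k) (t (k + 1))) : hat N t (k + 1) s = (s - t k) / tau t (k + 1) := by
  rw [hat]
  split_ifs with h1 h2
  -- at the node `t (k + 1)` the other branch of the definition applies and gives the same value
  · have hst : s = t (k + 1) := le_antisymm hs.2 h1.2.1
    have h3 := ht.tau_pos h1.1
    have h4 := ht.tau_pos hk
    rw [hst]
    simp only [tau, add_tsub_cancel_right] at h3 h4 ⊢
    rw [div_self h3.ne', div_self h4.ne']
  · simp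
  · exact absurd ⟨by omega, by simpa using hs⟩ h2

lemma IsPartition.hat_eq_zero (ht : IsPartition T N t) {k j : ℕ} (hk : k < N) (hj : j ≤ N) {s : ℝ}
    (hs : s ∈ Icc (t k) (t (k + 1))) (h1 : j ≠ k) (h2 : j ≠ k + 1) : hat N t j s = 0 := by
  rw [hat]
  split_ifs with hA hB
  · rcases Nat.lt_or_ge j k with h | h
    · have := ht.le_of_le (show j + 1 ≤ k by omega) hk.le
      rw [le_antisymm hA.2.2 (this.trans hs.1), sub_self, zero_div]
    · have := ht.lt_of_lt (show k + 1 < j by omega) hj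
      exact absurd (hA.2.1.trans hs.2) (not_le.2 this)
  · rcases Nat.lt_or_ge j k with h | h
    · have := ht.lt_of_lt h hk.le
      exact absurd (hs.1.trans hB.2.2) (not_le.2 this)
    · have := ht.le_of_le (show k + 1 ≤ j - 1 by omega) (by omega)
      rw [le_antisymm (hs.2.trans this) hB.2.1, sub_self, zero_div]
  · rfl

lemma IsPartition.interp_eq (ht : IsPartition T N t) (w : ℕ → H1 Ω) {k : ℕ} (hk : k < N) {s : ℝ}
    (hs : s ∈ Icc (t k) (t (k + 1))) :
    interp N t w s = w k + (s - t k) • ((tau t (k + 1))⁻¹ • (w (k + 1) - w k)) := by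
  have hτ := (ht.tau_pos hk).ne'
  rw [interp, Finset.sum_eq_add_of_mem k (k + 1) (by simp; omega) (by simp; omega) (by omega)
    fun j hj hjk => by
      rw [ht.hat_eq_zero hk (by simp at hj; omega) hs hjk.1 hjk.2, zero_smul],
    hat_left hk hs, ht.hat_right hk hs]
  have : (t (k + 1) - s) / tau t (k + 1) = 1 - (s - t k) / tau t (k + 1) := by
    rw [eq_sub_iff_add_eq, ← add_div, div_eq_one_iff_eq hτ, tau]
    simp
  rw [this, sub_smul, one_smul, smul_smul, smul_sub, ← div_eq_mul_inv]
  abel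

lemma IsPartition.interp_zero (ht : IsPartition T N t) (w : ℕ → H1 Ω) (hN : 0 < N) :
    interp N t w 0 = w 0 := by
  rw [ht.interp_eq w hN (by rw [← ht.zero]; exact ⟨le_rfl, (ht.lt 0 hN).le⟩), ht.zero]
  simp

lemma IsPartition.interp_last (ht : IsPartition T N t) (w : ℕ → H1 Ω) (hN : 0 < N) :
    interp N t w T = w N := by
  obtain ⟨n, rfl⟩ : ∃ n, N = n + 1 := ⟨N - 1, by omega⟩
  have hn : n < n + 1 := by omega
  have hτ := (ht.tau_pos hn).ne'
  rw [← ht.last, ht.interp_eq w hn ⟨(ht.lt n hn).le, le_rfl⟩]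
  simp only [tau, add_tsub_cancel_right] at hτ ⊢
  rw [smul_inv_smul₀ hτ]
  abel

lemma IsPartition.hasDerivAt_interp (ht : IsPartition T N t) (w : ℕ → H1 Ω) {k : ℕ} (hk : k < N)
    {s : ℝ} (hs : s ∈ Ioo (t k) (t (k + 1))) :
    HasDerivAt (interp N t w) ((tau t (k + 1))⁻¹ • (w (k + 1) - w k)) s := by
  have h1 : HasDerivAt (fun s => w k + (s - t k) • ((tau t (k + 1))⁻¹ • (w (k + 1) - w k)))
      ((tau t (k + 1))⁻¹ • (w (k + 1) - w k)) s := by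
    simpa using (((hasDerivAt_id s).sub_const (t k)).smul_const
      ((tau t (k + 1))⁻¹ • (w (k + 1) - w k))).const_add (w k)
  refine h1.congr_of_eventuallyEq ?_
  filter_upwards [Ioo_mem_nhds hs.1 hs.2] with r hr using ht.interp_eq w hk (Ioo_subset_Icc_self hr)

lemma IsPartition.continuousOn_interp (ht : IsPartition T N t) (w : ℕ → H1 Ω) :
    ContinuousOn (interp N t w) (Icc 0 T) := by
  have hloc : ∀ k < N, ContinuousOn (interp N t w) (Icc (t k) (t (k + 1))) := by
    intro k hk
    refine ContinuousOn.congr (f := fun s => w k + (s - t k) • ((tau t (k + 1))⁻¹ •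
      (w (k + 1) - w k))) (by fun_prop) fun s hs => ht.interp_eq w hk hs
  have key : ∀ n ≤ N, ContinuousOn (interp N t w) (Icc (t 0) (t n)) := by
    intro n hn
    induction n with
    | zero => simp
    | succ n ih =>
      rw [← Icc_union_Icc_eq_Icc (ht.le_of_le (Nat.zero_le n) (by omega)) (ht.lt n (by omega)).le]
      exact (ih (by omega)).union_of_isClosed (hloc n (by omega)) isClosed_Icc isClosed_Icc
  rw [← ht.zero, ← ht.last]
  exact key N le_rfl

/-- The derivative of the piecewise linear reconstruction, as a step function. -/
noncomputable def interpDeriv (N : ℕ) (t : ℕ → ℝ) (w : ℕ → H1 Ω) (s : ℝ) : H1 Ω :=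
  ∑ k ∈ Finset.range N, (Ioc (t k) (t (k + 1))).indicator
    (fun _ => (tau t (k + 1))⁻¹ • (w (k + 1) - w k)) s

lemma memL2_interpDeriv (T : ℝ) (w : ℕ → H1 Ω) : MemL2 T (interpDeriv N t w) := by
  unfold interpDeriv
  exact memLp_finsetSum _ fun k _ => (memLp_const _).indicator measurableSet_Ioc

lemma IsPartition.interpDeriv_eq (ht : IsPartition T N t) (w : ℕ → H1 Ω) {k : ℕ} (hk : k < N)
    {s : ℝ} (hs : s ∈ Ioc (t k) (t (k + 1))) :
    interpDeriv N t w s = (tau t (k + 1))⁻¹ • (w (k + 1) - w k) := by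
  rw [interpDeriv, Finset.sum_eq_single_of_mem k (Finset.mem_range.2 hk), indicator_of_mem hs]
  intro j hj hjk
  refine indicator_of_notMem (fun hs' => ?_) _
  rw [Finset.mem_range] at hj
  rcases Nat.lt_or_ge j k with h | h
  · exact absurd (hs'.2.trans (ht.le_of_le (show j + 1 ≤ k by omega) hk.le)) (not_le.2 hs.1)
  · exact absurd (hs.2.trans (ht.le_of_le (show k + 1 ≤ j by omega) hj.le)) (not_le.2 hs'.1)

lemma IsPartition.hasDerivAt_interp' (ht : IsPartition T N t) (w : ℕ → H1 Ω) {s : ℝ}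
    (hs : s ∈ Ioc 0 T) (hs' : s ∉ range t) :
    HasDerivAt (interp N t w) (interpDeriv N t w s) s := by
  obtain ⟨k, hk, hsk⟩ := ht.exists_mem_Ioc hs
  rw [ht.interpDeriv_eq w hk hsk]
  exact ht.hasDerivAt_interp w hk ⟨hsk.1, lt_of_le_of_ne hsk.2 fun h => hs' ⟨_, h.symm⟩⟩

lemma IsPartition.hasWeakDeriv_interp (ht : IsPartition T N t) (hT : 0 < T) (w : ℕ → H1 Ω) :
    HasWeakDeriv (valL Ω) T (interp N t w) (fun s => pivot (valL Ω) (interpDeriv N t w s)) :=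
  hasWeakDeriv_of_hasDerivAt (valL Ω) hT (countable_range t) (ht.continuousOn_interp w)
    (fun _ hs => ht.hasDerivAt_interp' w (Ioo_subset_Ioc_self hs.1) hs.2) (memL2_interpDeriv T w)

end Partition

variable {T ε : ℝ} {N : ℕ} {t : ℕ → ℝ}

/-! ### The dual-weighted residual -/

/-- The residual of the piecewise linear reconstruction, tested with `z s`. -/
noncomputable def weightedRes (N : ℕ) (t : ℕ → ℝ) (ε : ℝ) (f : ℝ → H1Dual Ω) (w : ℕ → H1 Ω)
    (z : ℝ → H1 Ω) (s : ℝ) : ℝ :=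
  f s (z s) - inner ℝ (val (deriv (interp N t w) s)) (val (z s))
    - inner ℝ (grad (interp N t w s)) (grad (z s))
    - 1 / ε ^ 2 * compPair (deriv psi) (val (interp N t w s)) (val (z s))

/-- At the nodes the reconstruction need not be differentiable and `deriv` may take the junk value
zero; the nodes form a null set. -/
lemma IsPartition.deriv_interp_ae_eq (ht : IsPartition T N t) (w : ℕ → H1 Ω) :
    ∀ᵐ s, s ∈ Ioc 0 T → deriv (interp N t w) s = interpDeriv N t w s := by
  filter_upwards [(countable_range t).ae_notMem volume] with s hs hsT
  exact (ht.hasDerivAt_interp' w hsT hs).deriv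

/-- The residual as a sum of pairings of square integrable functions. -/
lemma IsPartition.weightedRes_ae_eq (ht : IsPartition T N t) (f : ℝ → H1Dual Ω) (w : ℕ → H1 Ω)
    (z : ℝ → H1 Ω) : ∀ᵐ s, s ∈ Ioc 0 T → weightedRes N t ε f w z s
      = f s (z s) - pivot (valL Ω) (interpDeriv N t w s) (z s)
        - inner ℝ (grad (interp N t w s)) (grad (z s))
        - 1 / ε ^ 2 * inner ℝ (psiDeriv (val (interp N t w s))) (val (z s)) := by
  filter_upwards [ht.deriv_interp_ae_eq w] with s hs hsT
  rw [weightedRes, hs hsT, compPair_deriv_psi, pivot_apply, valL_apply, valL_apply]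

lemma IsPartition.intervalIntegrable_weightedRes (ht : IsPartition T N t) (hT : 0 < T)
    {f : ℝ → H1Dual Ω} (hf : MemL2 T f) (w : ℕ → H1 Ω) {z : ℝ → H1 Ω} (hz : MemL2 T z) :
    IntervalIntegrable (weightedRes N t ε f w z) volume 0 T := by
  have hI := (ht.hasWeakDeriv_interp hT w).mem
  have hD := (ht.hasWeakDeriv_interp hT w).mem_deriv
  refine IntervalIntegrable.congr_ae ((((hf.intervalIntegrable_apply hT hz).sub
    (hD.intervalIntegrable_apply hT hz)).sub (hI.grad.intervalIntegrable_inner hT hz.grad)).sub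
    ((hI.val.psiDeriv.intervalIntegrable_inner hT hz.val).const_mul (1 / ε ^ 2))) ?_
  rw [Filter.EventuallyEq, uIoc_of_le hT.le, ae_restrict_iff' measurableSet_Ioc]
  filter_upwards [ht.weightedRes_ae_eq (ε := ε) f w z] with s hs hsT using (hs hsT).symm

/-- The goal error is the residual of the reconstruction weighted with the dual solution: the
primal problem is tested with `z`, the dual one with the error, and the time derivatives are
exchanged by integration by parts. -/
lemma goal_sub_goal_eq (hT : 0 < T) {f : ℝ → H1Dual Ω} (hf : MemL2 T f) {u0 qbar : L2 Ω}
    {q : ℝ → L2 Ω} (hq : MemL2 T q) (ht : IsPartition T N t) {u : ℝ → H1 Ω}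
    (hu : IsPrimalSol T ε f u0 u) (w : ℕ → H1 Ω) {z : ℝ → H1 Ω}
    (hz : IsDualSol T ε qbar q u (interp N t w) z) :
    goal T qbar q u - goal T qbar q (interp N t w)
      = inner ℝ (trace T z 0) (u0 - val (w 0)) + ∫ s in (0 : ℝ)..T, weightedRes N t ε f w z s := by
  have hN : 0 < N := by
    rcases Nat.eq_zero_or_pos N with rfl | h
    · exact absurd (ht.zero.symm.trans ht.last) hT.ne
    · exact h
  obtain ⟨du, huW, hu0, hpr⟩ := hu
  obtain ⟨dz, hzW, hzT, hdu⟩ := hz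
  have hI := ht.hasWeakDeriv_interp (Ω := Ω) hT w
  have hIc : IsContRep T (interp N t w) (fun s => val (interp N t w s)) :=
    ⟨(valL Ω).continuous.comp_continuousOn (ht.continuousOn_interp w),
      Filter.Eventually.of_forall fun _ => rfl⟩
  have cu := huW.isContRep_trace hT
  have cz := hzW.isContRep_trace hT
  have hIT : trace T (interp N t w) T = val (w N) := by
    have cI := isContRep_trace ⟨_, hIc⟩
    rw [eqOn_Icc_of_ae_eq hT cI.1 hIc.1 cI.2 ⟨hT.le, le_rfl⟩]
    exact congrArg val (ht.interp_last w hN)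
  -- the pairings that occur
  have iduz := huW.mem_deriv.intervalIntegrable_apply hT hzW.mem
  have idzu := hzW.mem_deriv.intervalIntegrable_apply hT huW.mem
  have idzI := hzW.mem_deriv.intervalIntegrable_apply hT hI.mem
  have iDz := hI.mem_deriv.intervalIntegrable_apply hT hzW.mem
  have ifz := hf.intervalIntegrable_apply hT hzW.mem
  have iguz := huW.mem.grad.intervalIntegrable_inner hT hzW.mem.grad
  have igIz := hI.mem.grad.intervalIntegrable_inner hT hzW.mem.grad
  have ipuz := huW.mem.val.psiDeriv.intervalIntegrable_inner hT hzW.mem.val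
  have ipIz := hI.mem.val.psiDeriv.intervalIntegrable_inner hT hzW.mem.val
  have iqu := hq.intervalIntegrable_inner hT huW.mem.val
  have iqI := hq.intervalIntegrable_inner hT hI.mem.val
  have e1 := hpr z hzW.mem
  simp only [compPair_deriv_psi] at e1
  rw [intervalIntegral.integral_add (iduz.add iguz) (ipuz.const_mul _),
    intervalIntegral.integral_add iduz iguz, intervalIntegral.integral_const_mul] at e1
  have e2 := hdu (fun s => u s - interp N t w s) (MemLp.sub huW.mem hI.mem)
  have e2l : ∀ s, -(dz s (u s - interp N t w s))
      + inner ℝ (grad (z s)) (grad (u s - interp N t w s))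
      + 1 / ε ^ 2 * meanLinPair psi (val (u s)) (val (interp N t w s)) (val (z s))
          (val (u s - interp N t w s))
      = (dz s (interp N t w s) - dz s (u s))
        + (inner ℝ (grad (u s)) (grad (z s)) - inner ℝ (grad (interp N t w s)) (grad (z s)))
        + 1 / ε ^ 2 * (inner ℝ (psiDeriv (val (u s))) (val (z s))
          - inner ℝ (psiDeriv (val (interp N t w s))) (val (z s))) := by
    intro s
    rw [val_sub, meanLinPair_psi_sub, grad_sub, map_sub, inner_sub_right, neg_sub,
      real_inner_comm (grad (z s)) (grad (u s)),
      real_inner_comm (grad (z s)) (grad (interp N t w s))]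
  simp only [e2l] at e2
  simp only [val_sub, inner_sub_right] at e2
  rw [intervalIntegral.integral_add ((idzI.sub idzu).add (iguz.sub igIz))
    ((ipuz.sub ipIz).const_mul _), intervalIntegral.integral_add (idzI.sub idzu) (iguz.sub igIz),
    intervalIntegral.integral_const_mul, intervalIntegral.integral_sub idzI idzu,
    intervalIntegral.integral_sub iguz igIz, intervalIntegral.integral_sub ipuz ipIz,
    intervalIntegral.integral_sub iqu iqI] at e2
  have e3 := huW.hasWeakDeriv.integral_add_eq hT hzW.hasWeakDeriv cu.1 cz.1 cu.2 cz.2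
  have e4 := hI.integral_add_eq hT hzW.hasWeakDeriv hIc.1 cz.1 hIc.2 cz.2
  rw [intervalIntegral.integral_add iduz idzu, hu0, hzT] at e3
  rw [intervalIntegral.integral_add iDz idzI, hzT, ht.interp_last w hN, ht.interp_zero w hN] at e4
  have e5 : ∫ s in (0 : ℝ)..T, weightedRes N t ε f w z s
      = (∫ s in (0 : ℝ)..T, f s (z s))
        - (∫ s in (0 : ℝ)..T, pivot (valL Ω) (interpDeriv N t w s) (z s))
        - (∫ s in (0 : ℝ)..T, inner ℝ (grad (interp N t w s)) (grad (z s)))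
        - 1 / ε ^ 2 * ∫ s in (0 : ℝ)..T, inner ℝ (psiDeriv (val (interp N t w s))) (val (z s)) := by
    rw [← intervalIntegral.integral_const_mul, ← intervalIntegral.integral_sub ifz iDz,
      ← intervalIntegral.integral_sub (ifz.sub iDz) igIz,
      ← intervalIntegral.integral_sub ((ifz.sub iDz).sub igIz) (ipIz.const_mul _)]
    refine intervalIntegral.integral_congr_ae ?_
    rw [uIoc_of_le hT.le]
    exact ht.weightedRes_ae_eq f w z
  -- in `e1`, ..., `e5` all terms but those of the claim cancel
  simp only [goal]
  rw [e5, hIT, inner_sub_right, real_inner_comm u0 (trace T z 0),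
    real_inner_comm (val (w 0)) (trace T z 0), real_inner_comm (trace T u T) qbar,
    real_inner_comm (val (w N)) qbar]
  linarith

/-! ### Splitting into spatial and temporal parts -/

lemma compPair_deriv_psi_sub (a b c : L2 Ω) :
    compPair (deriv psi) a (b - c) = compPair (deriv psi) a b - compPair (deriv psi) a c := by
  simp only [compPair_deriv_psi, inner_sub_right]

/-- The temporal integrand is the full residual minus contributions of the discrete dual value. -/
lemma RtIntegrand_eq (ψc ψe : ℝ → ℝ) (f : ℝ → H1Dual Ω) (uh : ℕ → H1 Ω) (zc : ℝ → H1 Ω)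
    (z : ℕ → H1 Ω) (k : ℕ) (s : ℝ) :
    RtIntegrand N t ε ψc ψe f uh zc z k s = weightedRes N t ε f uh zc s
      - (f s (z (k + 1)) - inner ℝ (val (deriv (interp N t uh) s)) (val (z (k + 1)))
        - inner ℝ (grad (uh (k + 1))) (grad (z (k + 1)))
        - 1 / ε ^ 2 * compPair (deriv ψc) (val (uh (k + 1))) (val (z (k + 1)))
        + 1 / ε ^ 2 * compPair (deriv ψe) (val (uh k)) (val (z (k + 1)))) := by
  simp only [RtIntegrand, resPDE, resTime, weightedRes, val_sub, grad_sub, map_sub,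
    inner_sub_right, compPair_deriv_psi_sub]
  ring

lemma IsPartition.deriv_interp_of_mem_Ioo (ht : IsPartition T N t) (w : ℕ → H1 Ω) {k : ℕ}
    (hk : k < N) {s : ℝ} (hs : s ∈ Ioo (t k) (t (k + 1))) :
    val (deriv (interp N t w) s) = (tau t (k + 1))⁻¹ • (val (w (k + 1)) - val (w k)) := by
  rw [(ht.hasDerivAt_interp w hk hs).deriv, val_smul, val_sub]

lemma IsPartition.intervalIntegrable_of_memL2 (ht : IsPartition T N t) (hT : 0 < T)
    {X : Type*} [NormedAddCommGroup X] {f : ℝ → X} (hf : MemL2 T f) {k : ℕ} (hk : k < N) :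
    IntervalIntegrable f volume (t k) (t (k + 1)) :=
  ht.intervalIntegrable ((intervalIntegrable_iff_integrableOn_Ioc_of_le hT.le).2
    hf.integrableOn) hk

/-- The integral of the data over a time step, in terms of its average. -/
lemma IsPartition.integral_apply_eq (ht : IsPartition T N t) (hT : 0 < T)
    {f : ℝ → H1Dual Ω} (hf : MemL2 T f) {k : ℕ} (hk : k < N) (v : H1 Ω) :
    ∫ s in (t k)..(t (k + 1)), f s v = tau t (k + 1) * favg t f (k + 1) v := by
  rw [intervalIntegral_dual_const (ht.intervalIntegrable_of_memL2 hT hf hk), favg, smul_apply,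
    smul_eq_mul, mul_inv_cancel_left₀ (ht.tau_pos hk).ne', Nat.add_sub_cancel]

/-- On a time step, the discrete contributions to the temporal integrand are integrable and
integrate to the spatial residual. -/
lemma IsPartition.integral_discrete_part (ht : IsPartition T N t) (hT : 0 < T)
    {f : ℝ → H1Dual Ω} (hf : MemL2 T f) (ψc ψe : ℝ → ℝ) (uh : ℕ → H1 Ω) {k : ℕ} (hk : k < N)
    (v : H1 Ω) :
    IntervalIntegrable (fun s => f s v - inner ℝ (val (deriv (interp N t uh) s)) (val v)
        - inner ℝ (grad (uh (k + 1))) (grad v)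
        - 1 / ε ^ 2 * compPair (deriv ψc) (val (uh (k + 1))) (val v)
        + 1 / ε ^ 2 * compPair (deriv ψe) (val (uh k)) (val v)) volume (t k) (t (k + 1)) ∧
    ∫ s in (t k)..(t (k + 1)), (f s v - inner ℝ (val (deriv (interp N t uh) s)) (val v)
        - inner ℝ (grad (uh (k + 1))) (grad v)
        - 1 / ε ^ 2 * compPair (deriv ψc) (val (uh (k + 1))) (val v)
        + 1 / ε ^ 2 * compPair (deriv ψe) (val (uh k)) (val v))
      = tau t (k + 1) * resSpace t ε ψc ψe f uh k v := by
  have hτ : tau t (k + 1) = t (k + 1) - t k := rfl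
  have hfi := ht.intervalIntegrable_of_memL2 hT hf hk
  have hfv : IntervalIntegrable (fun s => f s v) volume (t k) (t (k + 1)) :=
    intervalIntegrable_dual_const hfi v
  set c : ℝ := inner ℝ ((tau t (k + 1))⁻¹ • (val (uh (k + 1)) - val (uh k))) (val v)
    + inner ℝ (grad (uh (k + 1))) (grad v)
    + 1 / ε ^ 2 * compPair (deriv ψc) (val (uh (k + 1))) (val v)
    - 1 / ε ^ 2 * compPair (deriv ψe) (val (uh k)) (val v) with hc
  have heq : EqOn (fun s => f s v - c) (fun s => f s v
        - inner ℝ (val (deriv (interp N t uh) s)) (val v)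
        - inner ℝ (grad (uh (k + 1))) (grad v)
        - 1 / ε ^ 2 * compPair (deriv ψc) (val (uh (k + 1))) (val v)
        + 1 / ε ^ 2 * compPair (deriv ψe) (val (uh k)) (val v)) (Ioo (t k) (t (k + 1))) := by
    intro s hs
    simp only [ht.deriv_interp_of_mem_Ioo uh hk hs, hc]
    ring
  have hci : IntervalIntegrable (fun s => f s v - c) volume (t k) (t (k + 1)) :=
    hfv.sub intervalIntegrable_const
  have hle : t k ≤ t (k + 1) := (ht.lt k hk).le
  constructor
  · refine hci.congr_ae ?_
    rw [uIoc_of_le hle, ← restrict_Ioo_eq_restrict_Ioc]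
    exact (ae_restrict_iff' measurableSet_Ioo).2 (Filter.Eventually.of_forall heq)
  · rw [← intervalIntegral.integral_congr_Ioo_of_le hle heq,
      intervalIntegral.integral_sub hfv intervalIntegrable_const, ht.integral_apply_eq hT hf hk,
      intervalIntegral.integral_const, smul_eq_mul, ← hτ, resSpace, hc]
    ring

end AllenCahn

theorem mainTheorem4 {d : ℕ} {Ω : Set (EuclideanSpace ℝ (Fin d))}
    (hΩ : IsOpen Ω) (hΩb : Bornology.IsBounded Ω)
    {T ε : ℝ} (hT : 0 < T) (hε : 0 < ε)
    {ψc ψe : ℝ → ℝ} (hψ : AllenCahn.IsSplitting ψc ψe)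
    -- data of the problem and of the goal functional
    {f : ℝ → AllenCahn.H1Dual Ω} (hf : AllenCahn.MemL2 T f)
    {u0 qbar : AllenCahn.L2 Ω} {q : ℝ → AllenCahn.L2 Ω} (hq : AllenCahn.MemL2 T q)
    -- time partition, meshes
    {N : ℕ} {t : ℕ → ℝ} (ht : AllenCahn.IsPartition T N t) (M : ℕ → AllenCahn.Mesh Ω)
    -- continuous, time-discrete and fully discrete primal solutions
    {u : ℝ → AllenCahn.H1 Ω} (hu : AllenCahn.IsPrimalSol T ε f u0 u)
    {uτ0 : AllenCahn.L2 Ω} {uτ : ℕ → AllenCahn.H1 Ω}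
    (huτ : AllenCahn.IsTimeDiscretePrimal N t ε ψc ψe f u0 uτ0 uτ)
    {uh : ℕ → AllenCahn.H1 Ω}
    (huh : AllenCahn.IsFullyDiscretePrimal N t ε ψc ψe f u0
      (fun k => AllenCahn.feSpace (M k) 1) uh)
    -- continuous and time-discrete dual solutions
    {z : ℝ → AllenCahn.H1 Ω}
    (hz : AllenCahn.IsDualSol T ε qbar q u (AllenCahn.interp N t uh) z)
    {zτ0 : AllenCahn.L2 Ω} {zτ : ℕ → AllenCahn.H1 Ω}
    (hzτ : AllenCahn.IsTimeDiscreteDual T N t ε ψc ψe qbar q uτ0 uτ uh zτ0 zτ) :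
    -- the integrands below are integrable
    (∀ k < N, IntervalIntegrable (fun s =>
        f s (z s)
          - inner ℝ (AllenCahn.val (deriv (AllenCahn.interp N t uh) s)) (AllenCahn.val (z s))
          - inner ℝ (AllenCahn.grad (AllenCahn.interp N t uh s)) (AllenCahn.grad (z s))
          - 1 / ε ^ 2 * AllenCahn.compPair (deriv AllenCahn.psi)
              (AllenCahn.val (AllenCahn.interp N t uh s)) (AllenCahn.val (z s)))
        volume (t k) (t (k + 1))) ∧
    (∀ k < N, IntervalIntegrable (AllenCahn.RtIntegrand N t ε ψc ψe f uh z zτ k)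
        volume (t k) (t (k + 1))) ∧
    -- the goal error is the dual-weighted space-time residual
    AllenCahn.goal T qbar q u - AllenCahn.goal T qbar q (AllenCahn.interp N t uh)
      = inner ℝ (AllenCahn.trace T z 0) (u0 - AllenCahn.val (uh 0))
        + ∑ k ∈ Finset.range N, ∫ s in (t k)..(t (k + 1)),
          (f s (z s)
            - inner ℝ (AllenCahn.val (deriv (AllenCahn.interp N t uh) s)) (AllenCahn.val (z s))
            - inner ℝ (AllenCahn.grad (AllenCahn.interp N t uh s)) (AllenCahn.grad (z s))
            - 1 / ε ^ 2 * AllenCahn.compPair (deriv AllenCahn.psi)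
                (AllenCahn.val (AllenCahn.interp N t uh s)) (AllenCahn.val (z s))) ∧
    -- decomposition into a spatial and a temporal part
    AllenCahn.goal T qbar q u - AllenCahn.goal T qbar q (AllenCahn.interp N t uh)
      = AllenCahn.Rs N t ε ψc ψe f u0 uh zτ0 zτ
        + AllenCahn.Rt T N t ε ψc ψe f u0 uh z zτ0 zτ ∧
    -- explicit form of the spatial part
    AllenCahn.Rs N t ε ψc ψe f u0 uh zτ0 zτ
      = inner ℝ zτ0 (u0 - AllenCahn.val (uh 0))
        + ∑ k ∈ Finset.range N, AllenCahn.tau t (k + 1) *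
          (AllenCahn.favg t f (k + 1) (zτ (k + 1))
            - inner ℝ ((AllenCahn.tau t (k + 1))⁻¹ •
                (AllenCahn.val (uh (k + 1)) - AllenCahn.val (uh k))) (AllenCahn.val (zτ (k + 1)))
            - inner ℝ (AllenCahn.grad (zτ (k + 1))) (AllenCahn.grad (uh (k + 1)))
            - 1 / ε ^ 2 * AllenCahn.compPair (deriv ψc)
                (AllenCahn.val (uh (k + 1))) (AllenCahn.val (zτ (k + 1)))
            + 1 / ε ^ 2 * AllenCahn.compPair (deriv ψe)
                (AllenCahn.val (uh k)) (AllenCahn.val (zτ (k + 1)))) ∧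
    -- explicit form of the temporal part
    AllenCahn.Rt T N t ε ψc ψe f u0 uh z zτ0 zτ
      = inner ℝ (AllenCahn.trace T z 0 - zτ0) (u0 - AllenCahn.val (uh 0))
        + ∑ k ∈ Finset.range N, ∫ s in (t k)..(t (k + 1)),
          (f s (z s - zτ (k + 1))
            - inner ℝ ((AllenCahn.tau t (k + 1))⁻¹ •
                (AllenCahn.val (uh (k + 1)) - AllenCahn.val (uh k)))
                (AllenCahn.val (z s - zτ (k + 1)))
            - inner ℝ (AllenCahn.grad (AllenCahn.interp N t uh s)) (AllenCahn.grad (z s))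
            + inner ℝ (AllenCahn.grad (uh (k + 1))) (AllenCahn.grad (zτ (k + 1)))
            - 1 / ε ^ 2 * AllenCahn.compPair (deriv AllenCahn.psi)
                (AllenCahn.val (AllenCahn.interp N t uh s)) (AllenCahn.val (z s))
            + 1 / ε ^ 2 * AllenCahn.compPair (deriv ψc)
                (AllenCahn.val (uh (k + 1))) (AllenCahn.val (zτ (k + 1)))
            - 1 / ε ^ 2 * AllenCahn.compPair (deriv ψe)
                (AllenCahn.val (uh k)) (AllenCahn.val (zτ (k + 1)))) ∧
    -- the data oscillation vanishes
    AllenCahn.Osc N t f zτ = 0 := by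

  have hzm : AllenCahn.MemL2 T z := by
    obtain ⟨dz, hzW, -⟩ := hz
    exact hzW.mem
  have hres := ht.intervalIntegrable_weightedRes (ε := ε) hT hf uh hzm
  have hres' : ∀ k < N, IntervalIntegrable (AllenCahn.weightedRes N t ε f uh z) volume
      (t k) (t (k + 1)) := fun k hk => ht.intervalIntegrable hres hk
  have hgoal := AllenCahn.goal_sub_goal_eq hT hf hq ht hu uh hz
  rw [← ht.sum_integral hres] at hgoal
  have hpart := fun k (hk : k < N) =>
    ht.integral_discrete_part (ε := ε) hT hf ψc ψe uh hk (zτ (k + 1))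
  refine ⟨hres', fun k hk => ?_, hgoal, ?_, ?_, ?_, ?_⟩
  · refine ((hres' k hk).sub (hpart k hk).1).congr fun s _ => ?_
    exact (AllenCahn.RtIntegrand_eq ψc ψe f uh z zτ k s).symm
  · rw [hgoal, AllenCahn.Rs, AllenCahn.Rt]
    have hk : ∀ k ∈ Finset.range N,
        ∫ s in (t k)..(t (k + 1)), AllenCahn.RtIntegrand N t ε ψc ψe f uh z zτ k s
          = (∫ s in (t k)..(t (k + 1)), AllenCahn.weightedRes N t ε f uh z s)
            - AllenCahn.tau t (k + 1) * AllenCahn.resSpace t ε ψc ψe f uh k (zτ (k + 1)) := by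
      intro k hk
      have hk' := Finset.mem_range.1 hk
      rw [← (hpart k hk').2, ← intervalIntegral.integral_sub (hres' k hk') (hpart k hk').1]
      exact intervalIntegral.integral_congr fun s _ => AllenCahn.RtIntegrand_eq ψc ψe f uh z zτ k s
    rw [Finset.sum_congr rfl hk, Finset.sum_sub_distrib, inner_sub_right (u0 - _),
      real_inner_comm (AllenCahn.trace T z 0) (u0 - AllenCahn.val (uh 0))]
    ring
  · rw [AllenCahn.Rs, real_inner_comm]
    simp only [AllenCahn.resSpace, real_inner_comm]
  · rw [AllenCahn.Rt, real_inner_comm]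
    congr 1
    refine Finset.sum_congr rfl fun k hk => ?_
    have hk' := Finset.mem_range.1 hk
    refine intervalIntegral.integral_congr_Ioo_of_le (ht.lt k hk').le fun s hs => ?_
    simp only [AllenCahn.RtIntegrand, AllenCahn.resPDE, AllenCahn.resTime,
      ht.deriv_interp_of_mem_Ioo uh hk' hs, AllenCahn.grad_sub, AllenCahn.val_sub,
      inner_sub_right, AllenCahn.compPair_deriv_psi_sub]
    ring
  · refine Finset.sum_eq_zero fun k hk => ?_
    have hk' := Finset.mem_range.1 hk
    have hfi := ht.intervalIntegrable_of_memL2 hT hf hk'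
    have hfv : IntervalIntegrable (fun s => f s (zτ (k + 1))) volume (t k) (t (k + 1)) :=
      AllenCahn.intervalIntegrable_dual_const hfi _
    simp only [sub_apply]
    rw [intervalIntegral.integral_sub hfv intervalIntegrable_const,
      ht.integral_apply_eq hT hf hk', intervalIntegral.integral_const, smul_eq_mul,
      AllenCahn.tau, Nat.add_sub_cancel, sub_self]
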